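/- **Setting.** Let $\delta\in(0,1)$ be a discount factor, $X\subset\mathbb R_+$ a Borel set with $0\in X$ and $\bar x=\sup X<\infty$, and $x_0\in(0,\bar x]$ an outside option. Alternatives $x_1,x_2,\dots$ are i.i.d. draws from an unknown distribution $F$ (the environment); $\mathcal F_X$ is the set of all probability distributions on $X$ with finite mean. A decision rule $p$ prescribes for each history $h=(x_0,x_1,\dots,x_t)$ a probability $p(h)\in[0,1]$ of stopping; stopping after $h$ gives the best-so-far alternative $y=\max\{x_0,\dots,x_t\}$, otherwise one more alternative is drawn and payoffs are discounted by $\delta$ (never stopping gives $0$). A prior $\mu$ is a finitely supported probability distribution on $\mathcal F_X$; it is consistent with $h$ if $x_1,\dots,x_t$ occurs with positive probability under $\mu$. Let $U_p(\mu,h)$ be the expected payoff of $p$ under $\mu$ conditional on $h$, let $V(\mu,h)=\sup_pU_p(\mu,h)$, and let $$R_p(x_0,\mathcal F_X)=\inf_{h}\ \inf_{\mu\text{ consistent with }h}\frac{U_p(\mu,h)}{V(\mu,h)},\qquad R^*(x_0,\mathcal F_X)=\sup_pR_p(x_0,\mathcal F_X),$$ where $h$ runs over all histories starting with $x_0$.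 The rule $p$ is dynamically robust if $R_p(x_0,\mathcal F_X)=R^*(x_0,\mathcal F_X)$. For $x\in[0,1]$ let $$q^*(x)=\frac{2(1-\delta)}{4-2\delta+x-\sqrt{x(x+8)}},\qquad \rho(x)=\frac12+\frac18\left(x+\sqrt{x(x+8)}\right).$$ **Theorem.** There is a constant $L\in(0,1)$, independent of $\delta$, $X$ and $x_0$, such that $$R^*(x_0,\mathcal F_X)\ \ge\ \rho(x_0/\bar x)\ >\ \tfrac12\qquad\text{whenever } x_0/\bar x\ge L.$$ Moreover, if $x_0/\bar x\ge 1/6$, then the decision rule $p^*$ that stops with probability $q^*(y/\bar x)$ when the best-so-far alternative is $y$ (a) attains the performance ratio $R_{p^*}(x_0,\mathcal F_X)=\rho(x_0/\bar x)>1/2$; (b) is dynamically robust if $1/6\le x_0/\bar x\le \delta^2/(2-\delta)$. -/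

import Mathlib

open scoped ENNReal

noncomputable section

namespace RobustSearch

open MeasureTheory

/-- A decision rule: `prob t h` is the probability of stopping after the history
`h = (x₀, x₁, …, x_t)`. It may depend on the whole history. -/
structure DecisionRule where
  prob : ∀ t : ℕ, (Fin (t + 1) → ℝ) → ℝ
  prob_nonneg : ∀ t h, 0 ≤ prob t h
  prob_le_one : ∀ t h, prob t h ≤ 1
  measurable_prob : ∀ t, Measurable (prob t)

/-- The best-so-far alternative `y_t = max {x₀, …, x_t}`. -/
def best {t : ℕ} (h : Fin (t + 1) → ℝ) : ℝ :=
  Finset.univ.sup' Finset.univ_nonempty h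

/-- The history `h ⊕ x`. -/
def extend {t : ℕ} (h : Fin (t + 1) → ℝ) (x : ℝ) : Fin (t + 1 + 1) → ℝ :=
  Fin.snoc (α := fun _ => ℝ) h x

/-- Expected payoff, conditional on the history `h`, that the rule `p` collects in the environment
`F` from stopping within the next `n` rounds (the current one included), discounted to the
current round. -/
def truncatedPayoff (δ : ℝ) (p : DecisionRule) (F : ProbabilityMeasure ℝ) :
    ℕ → ∀ t : ℕ, (Fin (t + 1) → ℝ) → ℝ≥0∞
  | 0, _, _ => 0
  | n + 1, t, h =>
      ENNReal.ofReal (p.prob t h) * ENNReal.ofReal (best h) +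
        ENNReal.ofReal (1 - p.prob t h) * ENNReal.ofReal δ *
          ∫⁻ x, truncatedPayoff δ p F n (t + 1) (extend h x) ∂(F : Measure ℝ)

/-- Expected payoff `U_p(F, h)` of the rule `p` in the environment `F`, conditional on `h`:
the increasing limit of the payoffs collected within `n` rounds (never stopping yields `0`).
It satisfies the usual recursion, see `payoff_eq`. -/
def payoff (δ : ℝ) (p : DecisionRule) (F : ProbabilityMeasure ℝ) {t : ℕ}
    (h : Fin (t + 1) → ℝ) : ℝ≥0∞ :=
  ⨆ n, truncatedPayoff δ p F n t h

/-- The probability that an i.i.d. sequence with law `F` starts with `x₁, …, x_t`,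
where `h = (x₀, x₁, …, x_t)`. -/
def likelihood (F : ProbabilityMeasure ℝ) {t : ℕ} (h : Fin (t + 1) → ℝ) : ℝ≥0∞ :=
  ∏ i : Fin t, (F : Measure ℝ) {h i.succ}

/-- The probability of `x₁, …, x_t` under the prior `μ`. -/
def priorLikelihood (μ : PMF (ProbabilityMeasure ℝ)) {t : ℕ} (h : Fin (t + 1) → ℝ) : ℝ≥0∞ :=
  ∑' F, μ F * likelihood F h

/-- The posterior probability `μ(F | h)` (Bayes' rule). -/
def posterior (μ : PMF (ProbabilityMeasure ℝ)) {t : ℕ} (h : Fin (t + 1) → ℝ)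
    (F : ProbabilityMeasure ℝ) : ℝ≥0∞ :=
  μ F * likelihood F h / priorLikelihood μ h

/-- `Δ(𝓕(h))`: the finitely supported priors over `𝓕` under which `h` has positive probability. -/
def consistentPriors (𝓕 : Set (ProbabilityMeasure ℝ)) {t : ℕ} (h : Fin (t + 1) → ℝ) :
    Set (PMF (ProbabilityMeasure ℝ)) :=
  {μ | μ.support.Finite ∧ μ.support ⊆ 𝓕 ∧ 0 < priorLikelihood μ h}

/-- Expected payoff `U_p(μ, h)` of the rule `p` under the prior `μ`, conditional on `h`. -/
def priorPayoff (δ : ℝ) (p : DecisionRule) (μ : PMF (ProbabilityMeasure ℝ)) {t : ℕ}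
    (h : Fin (t + 1) → ℝ) : ℝ≥0∞ :=
  ∑' F, posterior μ h F * payoff δ p F h

/-- The optimal payoff `V(μ, h)`. -/
def optimalPayoff (δ : ℝ) (μ : PMF (ProbabilityMeasure ℝ)) {t : ℕ} (h : Fin (t + 1) → ℝ) : ℝ≥0∞ :=
  ⨆ p : DecisionRule, priorPayoff δ p μ h

/-- The performance ratio `R_p(x₀, 𝓕)`. Histories with alternatives outside the range of `𝓕` have
no consistent priors, hence do not contribute to the infimum. -/
def performanceRatio (δ : ℝ) (p : DecisionRule) (x₀ : ℝ) (𝓕 : Set (ProbabilityMeasure ℝ)) : ℝ≥0∞ :=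
  ⨅ (t : ℕ) (h : Fin (t + 1) → ℝ) (_ : h 0 = x₀) (μ ∈ consistentPriors 𝓕 h),
    priorPayoff δ p μ h / optimalPayoff δ μ h

/-- The dynamically robust performance ratio `R^*(x₀, 𝓕)`. -/
def robustRatio (δ x₀ : ℝ) (𝓕 : Set (ProbabilityMeasure ℝ)) : ℝ≥0∞ :=
  ⨆ p : DecisionRule, performanceRatio δ p x₀ 𝓕

/-- A decision rule is dynamically robust if it attains the dynamically robust ratio. -/
def IsDynamicallyRobust (δ : ℝ) (p : DecisionRule) (x₀ : ℝ)
    (𝓕 : Set (ProbabilityMeasure ℝ)) : Prop :=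
  performanceRatio δ p x₀ 𝓕 = robustRatio δ x₀ 𝓕

/-- `𝓕_X`: all probability distributions over `X` with a finite mean. -/
def environments (X : Set ℝ) : Set (ProbabilityMeasure ℝ) :=
  {F | (F : Measure ℝ) Xᶜ = 0 ∧ Integrable (fun x : ℝ => x) (F : Measure ℝ)}

/-- `q^*(x) = 2(1-δ) / (4 - 2δ + x - √(x(x+8)))`. -/
def qStar (δ x : ℝ) : ℝ :=
  2 * (1 - δ) / (4 - 2 * δ + x - √(x * (x + 8)))

/-- `ρ(x) = 1/2 + (x + √(x(x+8)))/8`. -/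
def rho (x : ℝ) : ℝ :=
  1 / 2 + 1 / 8 * (x + √(x * (x + 8)))

theorem measurable_best (t : ℕ) : Measurable (best : (Fin (t + 1) → ℝ) → ℝ) := by
  have h : Measurable (Finset.univ.sup' Finset.univ_nonempty
      (fun (i : Fin (t + 1)) (h : Fin (t + 1) → ℝ) => h i)) :=
    Finset.measurable_sup' _ (fun i _ => measurable_pi_apply i)
  convert h using 1
  ext h
  simp [best, Finset.sup'_apply]

/-- The stationary rule `p^*(y) = q^*(y / x̄)`, where `y` is the best-so-far alternative. On
`0 ≤ y ≤ x̄` the truncation to `[0, 1]` has no effect, see `pStar_prob`; histories with `y > x̄`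
never occur. -/
def pStar (δ xbar : ℝ) : DecisionRule where
  prob t h := max 0 (min 1 (qStar δ (best h / xbar)))
  prob_nonneg _ _ := le_max_left _ _
  prob_le_one _ _ := max_le zero_le_one (min_le_left _ _)
  measurable_prob t := by
    have := measurable_best t
    unfold qStar
    fun_prop

theorem pStar_prob {δ xbar : ℝ} (hδ₁ : δ < 1) (hx : 0 < xbar) {t : ℕ}
    (h : Fin (t + 1) → ℝ) (h0 : 0 ≤ best h) (h1 : best h ≤ xbar) :
    (pStar δ xbar).prob t h = qStar δ (best h / xbar) := by
  have hy0 : 0 ≤ best h / xbar := by positivity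
  have hy1 : best h / xbar ≤ 1 := (div_le_one hx).2 h1
  change max 0 (min 1 (qStar δ (best h / xbar))) = _
  generalize best h / xbar = y at hy0 hy1
  have hs : √(y * (y + 8)) ≤ y + 2 := by
    rw [Real.sqrt_le_left (by linarith)]
    nlinarith
  have hD : 2 * (1 - δ) ≤ 4 - 2 * δ + y - √(y * (y + 8)) := by linarith
  have hq0 : 0 ≤ qStar δ y := div_nonneg (by linarith) (by linarith)
  have hq1 : qStar δ y ≤ 1 := (div_le_one (by linarith)).2 hD
  rw [min_eq_right hq1, max_eq_right hq0]

theorem measurable_extend (t : ℕ) :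
    Measurable (fun z : (Fin (t + 1) → ℝ) × ℝ => extend z.1 z.2) := by
  refine measurable_pi_lambda _ fun i => ?_
  refine Fin.lastCases ?_ (fun j => ?_) i
  · simpa [extend] using measurable_snd
  · simp only [extend, Fin.snoc_castSucc]
    exact (measurable_pi_apply j).comp measurable_fst

theorem measurable_truncatedPayoff (δ : ℝ) (p : DecisionRule) (F : ProbabilityMeasure ℝ) (n : ℕ) :
    ∀ t, Measurable (truncatedPayoff δ p F n t) := by
  induction n with
  | zero => intro t; exact measurable_const
  | succ n ih =>
    intro t
    have h1 := measurable_best t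
    have h2 := p.measurable_prob t
    have h3 : Measurable (fun h : Fin (t + 1) → ℝ =>
        ∫⁻ x, truncatedPayoff δ p F n (t + 1) (extend h x) ∂(F : Measure ℝ)) :=
      Measurable.lintegral_prod_right' ((ih (t + 1)).comp (measurable_extend t))
    change Measurable fun h => ENNReal.ofReal (p.prob t h) * ENNReal.ofReal (best h) +
        ENNReal.ofReal (1 - p.prob t h) * ENNReal.ofReal δ *
          ∫⁻ x, truncatedPayoff δ p F n (t + 1) (extend h x) ∂(F : Measure ℝ)
    fun_prop

theorem truncatedPayoff_le_succ (δ : ℝ) (p : DecisionRule) (F : ProbabilityMeasure ℝ) (n : ℕ) :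
    ∀ t (h : Fin (t + 1) → ℝ), truncatedPayoff δ p F n t h ≤ truncatedPayoff δ p F (n + 1) t h := by
  induction n with
  | zero => intro t h; exact zero_le
  | succ n ih =>
    intro t h
    rw [truncatedPayoff, truncatedPayoff]
    gcongr
    exact ih _ _

/-- The recursion `U_p(F, h) = p(h) y + (1 - p(h)) δ ∫ U_p(F, h ⊕ x) dF(x)`. -/
theorem payoff_eq (δ : ℝ) (p : DecisionRule) (F : ProbabilityMeasure ℝ) {t : ℕ}
    (h : Fin (t + 1) → ℝ) :
    payoff δ p F h = ENNReal.ofReal (p.prob t h) * ENNReal.ofReal (best h) +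
      ENNReal.ofReal (1 - p.prob t h) * ENNReal.ofReal δ *
        ∫⁻ x, payoff δ p F (extend h x) ∂(F : Measure ℝ) := by
  have hmono : ∀ (t : ℕ) (h : Fin (t + 1) → ℝ), Monotone fun n => truncatedPayoff δ p F n t h :=
    fun t h => monotone_nat_of_le_succ fun n => truncatedPayoff_le_succ δ p F n t h
  have hint : ∫⁻ x, payoff δ p F (extend h x) ∂(F : Measure ℝ) =
      ⨆ n, ∫⁻ x, truncatedPayoff δ p F n (t + 1) (extend h x) ∂(F : Measure ℝ) := by
    refine lintegral_iSup (fun n => ?_) (fun m n hmn x => hmono _ _ hmn)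
    exact (measurable_truncatedPayoff δ p F n (t + 1)).comp
      ((measurable_extend t).comp measurable_prodMk_left)
  rw [hint, ENNReal.mul_iSup, ENNReal.add_iSup, payoff, ← (hmono t h).iSup_nat_add 1]
  rfl

end RobustSearch

end

noncomputable section

namespace RobustSearch

open MeasureTheory

/-! Normalise the largest alternative to 1. A known environment has a reservation value `c = δ 𝔼
max(x, c)`, and its optimal payoff at best-so-far `y` is `max(y, c)`. Both payoffs under a prior are
handled by posterior averaging: the optimum is at most the average of the complete-information
optima, so a guarantee against each environment is a guarantee against each prior.

Guarantee (`le_payoff_pStar`). It suffices that `ρ(y) max(y, c)` is a subsolution of the payoff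
recursion under `p^*`. For `c ≤ y` this follows from stationarity and monotonicity of `ρ`. For `y <
c` the continuation value is bounded below by a function affine in `max(x, c)`, whose mean is known
to be `c/δ`; the slope is the one that makes the recursion an equality. What remains is
`chord_ineq`, a quadratic inequality in `c`. At `x = 1` the equation `ρ y = (2ρ - 1)²` gives this
quadratic a double root at `c = (2ρ - 1)/ρ`, which is where `ρ` comes from. For smaller `x` the
inequality is proved from `ρ(y) ≥ 2/3`, that is `y ≥ 1/6`.

Optimality (`performanceRatio_le_rho`). After `x₀, 0, …, 0` the environment may be worthless, so
that a rule must stop fast enough, or may yield a large `z` with some probability, so that it must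
stop slowly enough. Tuning that probability to the double root makes the two demands incompatible
for any ratio `R > ρ`. Rules that depend on time are covered by `false_of_recursions`: a ratio of
normalised payoffs would grow geometrically although it is bounded. The tuned probability exists
precisely when `ρ ≤ 1/(2 - δ)`, that is `x₀/x̄ ≤ δ²/(2 - δ)`. -/

/-! ### The functions `ρ` and `q^*` -/

theorem rho_mul_self {y : ℝ} (hy : 0 ≤ y) : rho y * y = (2 * rho y - 1) ^ 2 := by
  have hs : √(y * (y + 8)) ^ 2 = y * (y + 8) := Real.sq_sqrt (by positivity)
  unfold rho
  linear_combination (-1 / 16) * hs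

theorem rho_mono {y x : ℝ} (hy : 0 ≤ y) (hyx : y ≤ x) : rho y ≤ rho x := by
  have : √(y * (y + 8)) ≤ √(x * (x + 8)) := Real.sqrt_le_sqrt (by nlinarith)
  unfold rho
  linarith

theorem half_lt_rho {y : ℝ} (hy : 0 < y) : 1 / 2 < rho y := by
  have : 0 ≤ √(y * (y + 8)) := Real.sqrt_nonneg _
  unfold rho
  linarith

theorem rho_one : rho 1 = 1 := by
  have : √((1 : ℝ) * (1 + 8)) = 3 := by
    rw [show (1 : ℝ) * (1 + 8) = 3 ^ 2 by norm_num]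
    exact Real.sqrt_sq (by norm_num)
  rw [rho, this]
  norm_num

theorem rho_one_sixth : rho (1 / 6) = 2 / 3 := by
  have : √((1 / 6 : ℝ) * (1 / 6 + 8)) = 7 / 6 := by
    rw [show (1 / 6 : ℝ) * (1 / 6 + 8) = (7 / 6) ^ 2 by norm_num]
    exact Real.sqrt_sq (by norm_num)
  rw [rho, this]
  norm_num

theorem rho_le_one {y : ℝ} (hy : 0 ≤ y) (hy1 : y ≤ 1) : rho y ≤ 1 :=
  (rho_mono hy hy1).trans_eq rho_one

theorem rho_lt_one {y : ℝ} (hy : 0 ≤ y) (hy1 : y < 1) : rho y < 1 := by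
  refine lt_of_le_of_ne (rho_le_one hy hy1.le) fun h => ?_
  have := rho_mul_self hy
  rw [h] at this
  linarith

/-- Equivalent to `ρ = q + (1 - q) δ ρ`: stopping with constant probability `q` while nothing better
arrives is worth exactly the fraction `ρ` of the alternative in hand. -/
theorem qStar_mul {δ y : ℝ} (hδ : δ < 1) (hy : 0 ≤ y) (hy1 : y ≤ 1) :
    qStar δ y * (1 - δ * rho y) = rho y * (1 - δ) := by
  have hs : √(y * (y + 8)) ≤ y + 2 := by
    rw [Real.sqrt_le_left (by linarith)]
    nlinarith
  have hsq : √(y * (y + 8)) ^ 2 = y * (y + 8) := Real.sq_sqrt (by positivity)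
  have hD : 4 - 2 * δ + y - √(y * (y + 8)) ≠ 0 := by linarith
  unfold qStar rho
  field_simp
  linear_combination 2 * (1 - δ) * hsq

/-! ### Polynomial inequalities behind the affine minorant -/

/-- Up to the factor `(1 - v) / 10000`, this is the polynomial of `chord_poly_high` at the upper
endpoint `r = v ^ 2 - 13 / 100 * (1 - v ^ 2)`. -/
theorem chord_poly_high_sextic {v : ℝ} (h1 : v ≤ 1)
    (h2 : 2 / 3 ≤ v ^ 2 - 13 / 100 * (1 - v ^ 2)) (h3 : 4 / 5 ≤ v) :
    0 ≤ 1300 - 676 * v - 23728 * v ^ 2 - 5876 * v ^ 3 + 62828 * v ^ 4 + 11752 * v ^ 5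
      - 45200 * v ^ 6 := by
  obtain ⟨t, rfl⟩ : ∃ t, v = 1 - t := ⟨1 - v, by ring⟩
  have h0 : 0 ≤ t := by linarith
  have h1 : t ≤ 161 / 1000 := by nlinarith
  have e2 : 0 ≤ t * (161 / 1000 - t) := mul_nonneg h0 (by linarith)
  nlinarith [mul_nonneg e2 h0, mul_nonneg (mul_nonneg e2 h0) h0,
    mul_nonneg (mul_nonneg (mul_nonneg e2 h0) h0) h0,
    mul_nonneg (mul_nonneg (mul_nonneg e2 h0) h0) (mul_nonneg h0 h0)]

/-- Up to the factor `(1 - v) / 9`, this is the same polynomial at the lower endpoint `r = 2 / 3`.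
-/
theorem chord_poly_high_quartic {v : ℝ} (h2 : 2 / 3 ≤ v ^ 2 - 13 / 100 * (1 - v ^ 2))
    (h3 : 4 / 5 ≤ v) : 0 ≤ -6 - 16 * v + 24 * v ^ 3 + 12 * v ^ 4 := by
  obtain ⟨t, rfl⟩ : ∃ t, v = 83 / 100 + t := ⟨v - 83 / 100, by ring⟩
  have h0 : 0 ≤ t := by nlinarith
  have : 0 ≤ t ^ 2 := sq_nonneg _
  have : 0 ≤ t ^ 3 := by positivity
  have : 0 ≤ t ^ 4 := by positivity
  nlinarith

/-- Nonnegativity of the discriminant term when `r` is well below `v ^ 2`. -/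
theorem chord_poly_high {r v : ℝ} (hr : 2 / 3 ≤ r) (hv : 4 / 5 ≤ v) (hv1 : v ≤ 1)
    (h : r ≤ v ^ 2 - 13 / 100 * (1 - v ^ 2)) :
    0 ≤ -4 * r ^ 2 * v * (2 * v + 1) +
      r * (-1 + v + 8 * v ^ 2 + 4 * v ^ 3 + 4 * v ^ 4 + 4 * v ^ 5) - 4 * v ^ 4 * (1 + v) := by
  have h2 := hr.trans h
  have e1 : 0 ≤ (1 - v) * (-6 - 16 * v + 24 * v ^ 3 + 12 * v ^ 4) :=
    mul_nonneg (by linarith) (chord_poly_high_quartic h2 hv)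
  have e2 := mul_nonneg (sub_nonneg.2 hv1) (chord_poly_high_sextic hv1 h2 hv)
  rcases h2.eq_or_lt with heq | hlt
  · obtain rfl : r = 2 / 3 := le_antisymm (heq ▸ h) hr
    linear_combination (1 / 9) * e1
  · have e3 := mul_nonneg (sub_nonneg.2 h) e1
    have e4 := mul_nonneg (sub_nonneg.2 hr) e2
    -- The polynomial is concave in `r`, so it lies above the line through its endpoint values; this
    -- product is the excess up to constants.
    have e5 : 0 ≤ v * (2 * v + 1) * (r - 2 / 3) * (v ^ 2 - 13 / 100 * (1 - v ^ 2) - r) *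
        (v ^ 2 - 13 / 100 * (1 - v ^ 2) - 2 / 3) :=
      mul_nonneg (mul_nonneg (mul_nonneg (by positivity) (by linarith)) (by linarith))
        (by linarith)
    refine nonneg_of_mul_nonneg_right (a := v ^ 2 - 13 / 100 * (1 - v ^ 2) - 2 / 3) ?_
      (by linarith)
    linear_combination (1 / 9) * e3 + (1 / 10000) * e4 + 4 * e5

/-- The expression is convex in `r` (`e2`) with nonnegative derivative at `r₀` (`e1`), so only the
smallest admissible `r` has to be checked. -/
theorem chord_poly_low_mono {r₀ r u : ℝ} (hr : 2 / 3 ≤ r₀) (h : r₀ ≤ r) (h1 : r ≤ u)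
    (hu : u ≤ 1)
    (h0 : 0 ≤ r₀ * (2 * u - 1) ^ 2 + u * (2 * r₀ - 1) ^ 2 - (1 - r₀) * u * (2 * u - 1) ^ 2
      - 2 * r₀ ^ 2 * (2 * u - 1) ^ 2) :
    0 ≤ r * (2 * u - 1) ^ 2 + u * (2 * r - 1) ^ 2 - (1 - r) * u * (2 * u - 1) ^ 2
      - 2 * r ^ 2 * (2 * u - 1) ^ 2 := by
  have e1 : 0 ≤ (2 * u - 1) ^ 2 + 4 * u * (2 * r₀ - 1) + u * (2 * u - 1) ^ 2
      - 4 * r₀ * (2 * u - 1) ^ 2 := by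
    nlinarith [mul_nonneg (sub_nonneg.2 hr) (sub_nonneg.2 hu),
      mul_nonneg (sub_nonneg.2 hr) (sub_nonneg.2 (hr.trans (h.trans h1)))]
  have e2 : 0 ≤ 4 * u - 2 * (2 * u - 1) ^ 2 := by nlinarith
  linear_combination h0 + mul_nonneg (sub_nonneg.2 h) e1 + mul_nonneg (sq_nonneg (r - r₀)) e2

/-- The vertex of the quadratic lies to the right of `x` when `r` is close to `u`. -/
theorem chord_poly_low {r u : ℝ} (hr : 2 / 3 ≤ r) (h : u - 13 / 100 * (1 - u) ≤ r)
    (hru : r ≤ u) (hu : u ≤ 1) :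
    0 ≤ r * (2 * u - 1) ^ 2 + u * (2 * r - 1) ^ 2 - (1 - r) * u * (2 * u - 1) ^ 2
      - 2 * r ^ 2 * (2 * u - 1) ^ 2 := by
  rcases le_total (2 / 3) (u - 13 / 100 * (1 - u)) with h2 | h2
  · refine chord_poly_low_mono h2 h hru hu ?_
    have e : 0 ≤ u * (2 * u - 1) ^ 2
        - 13 / 100 * ((2 * u - 1) ^ 2 * (1 - 3 * u) + 4 * u * (2 * u - 1))
        + (4 * u - 2 * (2 * u - 1) ^ 2) * (13 / 100) ^ 2 * (1 - u) := by
      obtain ⟨t, rfl⟩ : ∃ t, u = 705 / 1000 + t := ⟨u - 705 / 1000, by ring⟩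
      have h0 : 0 ≤ t := by nlinarith
      have : 0 ≤ t ^ 3 := by positivity
      nlinarith [mul_nonneg h0 h0]
    linear_combination mul_nonneg (sub_nonneg.2 hu) e
  · refine chord_poly_low_mono le_rfl hr hru hu ?_
    have h3 : u ≤ 7051 / 10000 := by linarith
    nlinarith [mul_nonneg (sub_nonneg.2 (hr.trans hru)) (sub_nonneg.2 h3)]

/-- The linear minorant behind the performance guarantee, in terms of `r = ρ(y)` and `u = ρ(x)`. -/
theorem chord_ineq {r u y x c : ℝ} (hr : 2 / 3 ≤ r) (hru : r ≤ u) (hu : u ≤ 1)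
    (hy : r * y = (2 * r - 1) ^ 2) (hx : u * x = (2 * u - 1) ^ 2) (hc0 : 0 ≤ c) (hcx : c ≤ x) :
    r * (c - y) * (x - c) ≤ (1 - r) * c * ((2 * u - 1) ^ 2 - r * c) := by
  obtain ⟨v, hv0, hvu⟩ : ∃ v : ℝ, 0 ≤ v ∧ v ^ 2 = u :=
    ⟨√u, Real.sqrt_nonneg _, Real.sq_sqrt (by linarith)⟩
  have hv1 : v ≤ 1 := by nlinarith
  have hvl : 4 / 5 ≤ v := by nlinarith
  -- Right side minus left side is a convex quadratic in `c`. Away from `u` it is a square plus a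
  -- nonnegative multiple of `c`; near `u` it decreases on `[0, x]` and is nonnegative at `x`. The
  -- constant 13/100 is a numerical choice for which both arguments work.
  by_cases hcase : r ≤ u - 13 / 100 * (1 - u)
  · obtain ⟨w, hw⟩ : ∃ w : ℝ, v * w = 2 * u - 1 := ⟨(2 * u - 1) / v, by field_simp⟩
    have hxw : x = w ^ 2 := by
      have : v ^ 2 * x = v ^ 2 * w ^ 2 := by rw [hvu, hx, ← hw, ← hvu]; ring
      exact mul_left_cancel₀ (by positivity) this
    have hH : 0 ≤ -4 * r ^ 2 * v * (2 * v + 1) +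
        r * (-1 + v + 8 * v ^ 2 + 4 * v ^ 3 + 4 * v ^ 4 + 4 * v ^ 5) - 4 * v ^ 4 * (1 + v) :=
      chord_poly_high hr hvl hv1 (by rwa [hvu])
    have hE : 0 ≤ 2 * r * (2 * r - 1) * w - r * w ^ 2 - (2 * r - 1) ^ 2
        + (1 - r) * v ^ 2 * w ^ 2 := by
      have : v ^ 2 * (2 * r * (2 * r - 1) * w - r * w ^ 2 - (2 * r - 1) ^ 2
        + (1 - r) * v ^ 2 * w ^ 2) = (1 - v) * (-4 * r ^ 2 * v * (2 * v + 1) +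
        r * (-1 + v + 8 * v ^ 2 + 4 * v ^ 3 + 4 * v ^ 4 + 4 * v ^ 5) - 4 * v ^ 4 * (1 + v)) := by
        have h1 : v * w = 2 * v ^ 2 - 1 := by rw [hw, hvu]
        have h2 : v ^ 2 * w ^ 2 = (2 * v ^ 2 - 1) ^ 2 := by rw [← h1]; ring
        linear_combination 2 * r * (2 * r - 1) * v * h1 + (-r + (1 - r) * v ^ 2) * h2
      have h3 : 0 ≤ (1 - v) * (-4 * r ^ 2 * v * (2 * v + 1) +
        r * (-1 + v + 8 * v ^ 2 + 4 * v ^ 3 + 4 * v ^ 4 + 4 * v ^ 5) - 4 * v ^ 4 * (1 + v)) :=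
        mul_nonneg (by linarith) hH
      rw [← this] at h3
      exact nonneg_of_mul_nonneg_right h3 (by positivity)
    have h4 := add_nonneg (sq_nonneg (r * c - (2 * r - 1) * w)) (mul_nonneg hc0 hE)
    rw [← hw, hxw]
    linear_combination h4 - (w ^ 2 - c) * hy
  · have hK : 0 ≤ u * (r * x + (2 * r - 1) ^ 2 - (1 - r) * (2 * u - 1) ^ 2 - 2 * r ^ 2 * x) := by
      have : u * (r * x + (2 * r - 1) ^ 2 - (1 - r) * (2 * u - 1) ^ 2 - 2 * r ^ 2 * x) =
        r * (2 * u - 1) ^ 2 + u * (2 * r - 1) ^ 2 - (1 - r) * u * (2 * u - 1) ^ 2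
          - 2 * r ^ 2 * (2 * u - 1) ^ 2 := by
        linear_combination (r - 2 * r ^ 2) * hx
      rw [this]
      exact chord_poly_low hr (le_of_not_ge hcase) hru hu
    have hB := nonneg_of_mul_nonneg_right hK (by linarith)
    have hx0 : 0 ≤ x := hc0.trans hcx
    have h1 : 0 ≤ (x - c) * (r * x + (2 * r - 1) ^ 2 - (1 - r) * (2 * u - 1) ^ 2
        - r ^ 2 * (c + x)) :=
      mul_nonneg (by linarith) (by nlinarith [sq_nonneg r])
    -- The value of the quadratic at `c = x`; `h1` is its drop from `c` to `x`.
    have h2 : 0 ≤ (1 - r) * x * (u - r) * x :=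
      mul_nonneg (mul_nonneg (mul_nonneg (by linarith) hx0) (by linarith)) hx0
    linear_combination h1 + h2 - (x - c) * hy + (1 - r) * x * hx

theorem rho_mul_max_ge {y x c : ℝ} (hy : 1 / 6 ≤ y) (hyc : y < c) (hx1 : x ≤ 1) :
    rho y * c + rho y * (c - y) / ((1 - rho y) * c) * (max x c - c) ≤
      rho (max y x) * max (max y x) c := by
  have hy0 : 0 ≤ y := by linarith
  rcases le_or_gt x c with hxc | hcx
  · rw [max_eq_right hxc, sub_self, mul_zero, add_zero, max_eq_right (max_le hyc.le hxc)]
    exact mul_le_mul_of_nonneg_right (rho_mono hy0 (le_max_left _ _)) (by linarith)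
  · have hyx : y ≤ x := (hyc.trans hcx).le
    rw [max_eq_right hyx, max_eq_left hcx.le]
    have hr1 : rho y < 1 := rho_lt_one hy0 (by linarith)
    have hru := rho_mono hy0 hyx
    have hu := rho_mul_self (hy0.trans hyx)
    have hr : 2 / 3 ≤ rho y := rho_one_sixth ▸ rho_mono (by norm_num) hy
    have key := chord_ineq hr hru (rho_le_one (hy0.trans hyx) hx1) (rho_mul_self hy0) hu
      (hy0.trans hyc.le) hcx.le
    have hpos : 0 < (1 - rho y) * c := mul_pos (by linarith) (by linarith)
    rw [← le_sub_iff_add_le', div_mul_eq_mul_div, div_le_iff₀ hpos, hu]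
    linarith

/-! ### Incompatible recursions -/

/-- Growth comparison: two recursions with different discount factors are incompatible when their
stationary stopping probabilities are. -/
theorem false_of_recursions {δ γ ε η : ℝ} {q a e : ℕ → ℝ} (hδ0 : 0 ≤ δ) (hδ1 : δ < 1)
    (hγ0 : 0 ≤ γ) (hγ1 : γ < 1) (hη : 0 < η)
    (ha : ∀ t, 0 ≤ a t) (haε : ∀ t, a t ≤ ε) (heη : ∀ t, η ≤ e t) (he1 : ∀ t, e t ≤ 1)
    (hrecA : ∀ t, (1 - q t) * (1 - δ + δ * a (t + 1)) ≤ a t)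
    (hrecE : ∀ t, e t ≤ (1 - q t) * (1 - γ + γ * e (t + 1)))
    (hlt : ε * (1 - γ + γ * η) < η * (1 - δ + δ * ε)) : False := by
  have hε : 0 ≤ ε := (ha 0).trans (haε 0)
  have hq : ∀ t, 0 < 1 - q t := fun t => by
    have h1 : 0 < 1 - γ + γ * e (t + 1) := by
      have := mul_nonneg hγ0 (hη.le.trans (heη (t + 1)))
      linarith
    have h2 := (hη.trans_le (heη t)).trans_le (hrecE t)
    exact (mul_pos_iff_of_pos_right h1).1 h2
  have hapos : ∀ t, 0 < a t := fun t => by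
    refine lt_of_lt_of_le (mul_pos (hq t) ?_) (hrecA t)
    have := mul_nonneg hδ0 (ha (t + 1))
    linarith
  have hεpos : 0 < ε := (hapos 0).trans_le (haε 0)
  set m := η * (1 - δ + δ * ε) with hm
  set l := ε * (1 - γ + γ * η) with hl
  have hl0 : 0 < l := mul_pos hεpos (by nlinarith)
  have hm0 : 0 < m := hl0.trans hlt
  -- Dividing the recursions cancels `1 - q t`. The remaining factor is largest at `e = η`, `a = ε`,
  -- where it equals `l / m < 1`.
  have step : ∀ t, e t / a t ≤ e (t + 1) / a (t + 1) * (l / m) := fun t => by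
    have he' := heη (t + 1)
    have ha' := haε (t + 1)
    have hap := hapos (t + 1)
    have e1 : e t / a t ≤ (1 - γ + γ * e (t + 1)) / (1 - δ + δ * a (t + 1)) := by
      have hd : 0 < 1 - δ + δ * a (t + 1) := by nlinarith
      rw [div_le_div_iff₀ (hapos t) hd]
      have hg : 0 ≤ 1 - γ + γ * e (t + 1) := by nlinarith
      calc e t * (1 - δ + δ * a (t + 1))
          ≤ (1 - q t) * (1 - γ + γ * e (t + 1)) * (1 - δ + δ * a (t + 1)) :=
            mul_le_mul_of_nonneg_right (hrecE t) hd.le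
        _ = (1 - γ + γ * e (t + 1)) * ((1 - q t) * (1 - δ + δ * a (t + 1))) := by ring
        _ ≤ _ := mul_le_mul_of_nonneg_left (hrecA t) hg
    refine e1.trans ?_
    have hd : 0 < 1 - δ + δ * a (t + 1) := by nlinarith
    rw [div_mul_div_comm, div_le_div_iff₀ hd (mul_pos hap hm0), hm, hl]
    have f1 : (1 - γ + γ * e (t + 1)) * η ≤ e (t + 1) * (1 - γ + γ * η) := by nlinarith
    have f2 : a (t + 1) * (1 - δ + δ * ε) ≤ ε * (1 - δ + δ * a (t + 1)) := by nlinarith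
    have g1 : 0 ≤ a (t + 1) * (1 - δ + δ * ε) := by
      refine mul_nonneg hap.le ?_
      nlinarith
    have g2 : 0 ≤ e (t + 1) * (1 - γ + γ * η) := mul_nonneg (by linarith) (by nlinarith)
    calc (1 - γ + γ * e (t + 1)) * (a (t + 1) * (η * (1 - δ + δ * ε)))
        = ((1 - γ + γ * e (t + 1)) * η) * (a (t + 1) * (1 - δ + δ * ε)) := by ring
      _ ≤ (e (t + 1) * (1 - γ + γ * η)) * (ε * (1 - δ + δ * a (t + 1))) :=
          mul_le_mul f1 f2 g1 g2
      _ = _ := by ring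
  have hκ0 : 0 ≤ l / m := by positivity
  have hκ1 : l / m < 1 := (div_lt_one hm0).2 hlt
  have iter : ∀ t, e 0 / a 0 ≤ e t / a t * (l / m) ^ t := fun t => by
    induction t with
    | zero => simp
    | succ t ih =>
      refine ih.trans ?_
      rw [pow_succ', ← mul_assoc]
      exact mul_le_mul_of_nonneg_right (step t) (by positivity)
  have bound : ∀ t, e t / a t ≤ 1 / (1 - δ) := fun t => by
    rw [div_le_div_iff₀ (hapos t) (by linarith), one_mul]
    refine le_trans ?_ (hrecA t)
    have h1 : e t ≤ 1 - q t := (hrecE t).trans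
      (mul_le_of_le_one_right (hq t).le (by nlinarith [he1 (t + 1)]))
    exact mul_le_mul h1 (by nlinarith [hapos (t + 1)]) (by linarith) (hq t).le
  have hlim : Filter.Tendsto (fun t : ℕ => 1 / (1 - δ) * (l / m) ^ t) Filter.atTop
      (nhds (1 / (1 - δ) * 0)) :=
    (tendsto_pow_atTop_nhds_zero_of_lt_one hκ0 hκ1).const_mul _
  have h0 : e 0 / a 0 ≤ 1 / (1 - δ) * 0 :=
    ge_of_tendsto' hlim fun t =>
      (iter t).trans (mul_le_mul_of_nonneg_right (bound t) (by positivity))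
  have : 0 < e 0 / a 0 := div_pos (hη.trans_le (heη 0)) (hapos 0)
  linarith

/-! ### Super- and subsolutions of the payoff recursion -/

theorem le_best {t : ℕ} (h : Fin (t + 1) → ℝ) (i : Fin (t + 1)) : h i ≤ best h :=
  Finset.le_sup' h (Finset.mem_univ i)

theorem best_le {t : ℕ} {h : Fin (t + 1) → ℝ} {b : ℝ} (hb : ∀ i, h i ≤ b) : best h ≤ b :=
  Finset.sup'_le _ _ fun i _ => hb i

theorem best_extend {t : ℕ} (h : Fin (t + 1) → ℝ) (x : ℝ) :
    best (extend h x) = max (best h) x := by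
  refine le_antisymm (best_le fun i => ?_) (max_le (best_le fun i => ?_) ?_)
  · refine Fin.lastCases ?_ (fun j => ?_) i
    · simp [extend]
    · simpa [extend] using Or.inl (le_best h j)
  · simpa [extend] using le_best (extend h x) i.castSucc
  · simpa [extend] using le_best (extend h x) (Fin.last _)

/-- Any supersolution of the recursion bounds the payoff from above. -/
theorem payoff_le_of_supersolution {δ : ℝ} {p : DecisionRule} {F : ProbabilityMeasure ℝ}
    {g : ℝ → ℝ≥0∞} {S : Set ℝ} (hS : ∀ y ∈ S, ∀ᵐ x ∂(F : Measure ℝ), max y x ∈ S)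
    (hg : ∀ (t : ℕ) (h : Fin (t + 1) → ℝ), best h ∈ S →
      ENNReal.ofReal (p.prob t h) * ENNReal.ofReal (best h) +
        ENNReal.ofReal (1 - p.prob t h) * ENNReal.ofReal δ *
          ∫⁻ x, g (max (best h) x) ∂(F : Measure ℝ) ≤ g (best h))
    {t : ℕ} (h : Fin (t + 1) → ℝ) (hh : best h ∈ S) : payoff δ p F h ≤ g (best h) := by
  refine iSup_le fun n => ?_
  induction n generalizing t with
  | zero => exact zero_le
  | succ n ih =>
    refine le_trans ?_ (hg t h hh)
    rw [truncatedPayoff]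
    refine add_le_add le_rfl (mul_le_mul' le_rfl (lintegral_mono_ae ?_))
    filter_upwards [hS _ hh] with x hx
    rw [← best_extend] at hx ⊢
    exact ih _ hx

/-- Any bounded subsolution of the recursion bounds the payoff from below. -/
theorem le_payoff_of_subsolution {δ : ℝ} (hδ1 : δ < 1) {p : DecisionRule}
    {F : ProbabilityMeasure ℝ} {g : ℝ → ℝ≥0∞} {S : Set ℝ} {M : ℝ≥0∞} (hM : M ≠ ∞)
    (hgM : ∀ y ∈ S, g y ≤ M)
    (hS : ∀ y ∈ S, ∀ᵐ x ∂(F : Measure ℝ), max y x ∈ S)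
    (hg : ∀ (t : ℕ) (h : Fin (t + 1) → ℝ), best h ∈ S →
      g (best h) ≤ ENNReal.ofReal (p.prob t h) * ENNReal.ofReal (best h) +
        ENNReal.ofReal (1 - p.prob t h) * ENNReal.ofReal δ *
          ∫⁻ x, g (max (best h) x) ∂(F : Measure ℝ))
    {t : ℕ} (h : Fin (t + 1) → ℝ) (hh : best h ∈ S) : g (best h) ≤ payoff δ p F h := by
  -- Truncating after `n` rounds costs at most `δ ^ n * M`, which vanishes in the limit.
  have key : ∀ (n t : ℕ) (h : Fin (t + 1) → ℝ), best h ∈ S →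
      g (best h) ≤ truncatedPayoff δ p F n t h + ENNReal.ofReal δ ^ n * M := by
    intro n
    induction n with
    | zero => intro t h hh; simpa [truncatedPayoff] using hgM _ hh
    | succ n ih =>
      intro t h hh
      refine (hg t h hh).trans ?_
      have h1 : ∫⁻ x, g (max (best h) x) ∂(F : Measure ℝ) ≤
          ∫⁻ x, truncatedPayoff δ p F n (t + 1) (extend h x) ∂(F : Measure ℝ) +
            ENNReal.ofReal δ ^ n * M := by
        calc ∫⁻ x, g (max (best h) x) ∂(F : Measure ℝ)
            ≤ ∫⁻ x, (truncatedPayoff δ p F n (t + 1) (extend h x) +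
                ENNReal.ofReal δ ^ n * M) ∂(F : Measure ℝ) := by
              refine lintegral_mono_ae ?_
              filter_upwards [hS _ hh] with x hx
              rw [← best_extend] at hx ⊢
              exact ih _ _ hx
          _ = _ := by
              rw [lintegral_add_right _ measurable_const]
              simp
      have h2 : ENNReal.ofReal (1 - p.prob t h) ≤ 1 := by
        rw [ENNReal.ofReal_le_one]
        linarith [p.prob_nonneg t h]
      rw [truncatedPayoff, add_assoc]
      gcongr
      calc _ ≤ ENNReal.ofReal (1 - p.prob t h) * ENNReal.ofReal δ *
            (∫⁻ x, truncatedPayoff δ p F n (t + 1) (extend h x) ∂(F : Measure ℝ) +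
              ENNReal.ofReal δ ^ n * M) := by gcongr
        _ = ENNReal.ofReal (1 - p.prob t h) * ENNReal.ofReal δ *
            ∫⁻ x, truncatedPayoff δ p F n (t + 1) (extend h x) ∂(F : Measure ℝ) +
            ENNReal.ofReal (1 - p.prob t h) * (ENNReal.ofReal δ ^ (n + 1) * M) := by ring
        _ ≤ _ := add_le_add le_rfl (mul_le_of_le_one_left zero_le h2)
  have hlim : Filter.Tendsto (fun n : ℕ => payoff δ p F h + ENNReal.ofReal δ ^ n * M)
      Filter.atTop (nhds (payoff δ p F h + 0 * M)) := by
    refine tendsto_const_nhds.add (ENNReal.Tendsto.mul_const ?_ (Or.inr hM))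
    exact ENNReal.tendsto_pow_atTop_nhds_zero_of_lt_one (by simpa using hδ1)
  rw [zero_mul, add_zero] at hlim
  exact ge_of_tendsto' hlim fun n =>
    (key n t h hh).trans (by gcongr; exact le_iSup (fun n => truncatedPayoff δ p F n t h) n)

/-- The rule that stops as soon as the best-so-far alternative is at least `z`. -/
def thresholdRule (z : ℝ) : DecisionRule where
  prob t h := if z ≤ best h then 1 else 0
  prob_nonneg t h := by split_ifs <;> norm_num
  prob_le_one t h := by split_ifs <;> norm_num
  measurable_prob t :=
    Measurable.ite (measurableSet_le measurable_const (measurable_best t))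
      measurable_const measurable_const

theorem payoff_thresholdRule_of_le (δ : ℝ) (F : ProbabilityMeasure ℝ) {z : ℝ} {t : ℕ}
    {h : Fin (t + 1) → ℝ} (hz : z ≤ best h) :
    payoff δ (thresholdRule z) F h = ENNReal.ofReal (best h) := by
  rw [payoff_eq]
  simp [thresholdRule, hz]

/-! ### Posteriors and point priors -/

section Bayes

variable {t : ℕ} {h : Fin (t + 1) → ℝ}

theorem likelihood_le_one (F : ProbabilityMeasure ℝ) (h : Fin (t + 1) → ℝ) :
    likelihood F h ≤ 1 :=
  Finset.prod_le_one' fun _ _ => prob_le_one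

theorem priorLikelihood_ne_top (μ : PMF (ProbabilityMeasure ℝ)) (h : Fin (t + 1) → ℝ) :
    priorLikelihood μ h ≠ ∞ := by
  refine ne_top_of_le_ne_top ENNReal.one_ne_top ?_
  calc priorLikelihood μ h ≤ ∑' F, μ F :=
        ENNReal.tsum_le_tsum fun F => mul_le_of_le_one_right zero_le (likelihood_le_one F h)
    _ = 1 := μ.tsum_coe

theorem tsum_posterior {μ : PMF (ProbabilityMeasure ℝ)} (hμ : 0 < priorLikelihood μ h) :
    ∑' F, posterior μ h F = 1 := by
  simp only [posterior, div_eq_mul_inv]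
  rw [ENNReal.tsum_mul_right]
  exact ENNReal.mul_inv_cancel hμ.ne' (priorLikelihood_ne_top μ h)

theorem posterior_ne_zero {μ : PMF (ProbabilityMeasure ℝ)} {F : ProbabilityMeasure ℝ}
    (hF : posterior μ h F ≠ 0) : F ∈ μ.support ∧ likelihood F h ≠ 0 := by
  refine ⟨fun h0 => hF ?_, fun h0 => hF ?_⟩ <;> simp [posterior, h0]

theorem priorPayoff_pure (δ : ℝ) (p : DecisionRule) {F : ProbabilityMeasure ℝ}
    (hF : likelihood F h ≠ 0) : priorPayoff δ p (PMF.pure F) h = payoff δ p F h := by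
  have hL : priorLikelihood (PMF.pure F) h = likelihood F h := by
    rw [priorLikelihood, tsum_eq_single F]
    · simp
    · intro G hG
      simp [PMF.pure_apply, hG]
  rw [priorPayoff, tsum_eq_single F]
  · rw [posterior, hL, PMF.pure_apply_self, one_mul, ENNReal.div_self hF, one_mul]
    exact ne_top_of_le_ne_top ENNReal.one_ne_top (likelihood_le_one F h)
  · intro G hG
    simp [posterior, PMF.pure_apply, hG]

theorem pure_mem_consistentPriors {𝓕 : Set (ProbabilityMeasure ℝ)} {F : ProbabilityMeasure ℝ}
    (hF : F ∈ 𝓕) (hL : likelihood F h ≠ 0) : PMF.pure F ∈ consistentPriors 𝓕 h := by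
  refine ⟨by simp, by simpa using hF, ?_⟩
  rw [priorLikelihood, tsum_eq_single F]
  · simpa using pos_iff_ne_zero.2 hL
  · intro G hG
    simp [PMF.pure_apply, hG]

/-- In particular, a performance ratio bounds the payoff in every single environment. -/
theorem performanceRatio_le_div {δ : ℝ} {p p' : DecisionRule} {𝓕 : Set (ProbabilityMeasure ℝ)}
    {F : ProbabilityMeasure ℝ} (hF : F ∈ 𝓕) (hL : likelihood F h ≠ 0) :
    performanceRatio δ p (h 0) 𝓕 ≤ payoff δ p F h / payoff δ p' F h := by
  calc performanceRatio δ p (h 0) 𝓕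
      ≤ priorPayoff δ p (PMF.pure F) h / optimalPayoff δ (PMF.pure F) h :=
        iInf_le_of_le t <| iInf_le_of_le h <| iInf_le_of_le rfl <|
          iInf₂_le _ (pure_mem_consistentPriors hF hL)
    _ ≤ _ := by
        rw [priorPayoff_pure δ p hL, ← priorPayoff_pure δ p' hL]
        gcongr
        exact le_iSup (fun p => priorPayoff δ p (PMF.pure F) h) p'

end Bayes

theorem ofReal_recursion {q y δ I : ℝ} (hq0 : 0 ≤ q) (hq1 : q ≤ 1) (hy : 0 ≤ y) (hδ : 0 ≤ δ)
    (hI : 0 ≤ I) :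
    ENNReal.ofReal q * ENNReal.ofReal y + ENNReal.ofReal (1 - q) * ENNReal.ofReal δ *
      ENNReal.ofReal I = ENNReal.ofReal (q * y + (1 - q) * δ * I) := by
  have h1 : 0 ≤ 1 - q := by linarith
  rw [← ENNReal.ofReal_mul hq0, ← ENNReal.ofReal_mul h1, ← ENNReal.ofReal_mul (by positivity),
    ← ENNReal.ofReal_add (by positivity) (by positivity)]

/-! ### Complete information: reservation value and guarantee of `p^*` -/

section Reservation

variable {F : ProbabilityMeasure ℝ}

theorem integrable_max (hI : Integrable (fun x : ℝ => x) (F : Measure ℝ)) (c : ℝ) :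
    Integrable (fun x : ℝ => max x c) (F : Measure ℝ) :=
  hI.sup (integrable_const c)

/-- The reservation value `c = δ 𝔼 max(x, c)` of an environment with values in `[0, B]`. -/
theorem exists_reservation {δ B : ℝ} (hδ0 : 0 ≤ δ) (hδ1 : δ ≤ 1) (hB : 0 ≤ B)
    (hI : Integrable (fun x : ℝ => x) (F : Measure ℝ))
    (hF : ∀ᵐ x ∂(F : Measure ℝ), x ∈ Set.Icc 0 B) :
    ∃ c, 0 ≤ c ∧ c ≤ B ∧ δ * ∫ x, max x c ∂(F : Measure ℝ) = c := by
  have hcont : Continuous fun c => ∫ x, max x c ∂(F : Measure ℝ) := by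
    refine (LipschitzWith.of_le_add fun c d => ?_).continuous
    have : ∫ x, max x c ∂(F : Measure ℝ) ≤ ∫ x, (max x d + dist c d) ∂(F : Measure ℝ) := by
      refine integral_mono (integrable_max hI c) ((integrable_max hI d).add (integrable_const _))
        fun x => ?_
      have h1 : c - d ≤ dist c d := le_abs_self _
      have h2 : 0 ≤ dist c d := dist_nonneg
      exact max_le (by linarith [le_max_left x d]) (by linarith [le_max_right x d])
    rwa [integral_add (integrable_max hI d) (integrable_const _), integral_const, probReal_univ,
      one_smul] at this
  have h0 : 0 ≤ δ * ∫ x, max x 0 ∂(F : Measure ℝ) - 0 := by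
    have : 0 ≤ ∫ x, max x 0 ∂(F : Measure ℝ) := integral_nonneg fun x => le_max_right _ _
    rw [sub_zero]
    positivity
  have h1 : δ * ∫ x, max x B ∂(F : Measure ℝ) - B ≤ 0 := by
    have : ∫ x, max x B ∂(F : Measure ℝ) = ∫ _, B ∂(F : Measure ℝ) := by
      refine integral_congr_ae ?_
      filter_upwards [hF] with x hx using max_eq_right hx.2
    rw [this, integral_const, probReal_univ, one_smul]
    nlinarith
  obtain ⟨c, hc, hc0⟩ := intermediate_value_Icc' hB
    (((hcont.const_mul δ).sub continuous_id).continuousOn (s := Set.Icc 0 B)) ⟨h1, h0⟩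
  exact ⟨c, hc.1, hc.2, sub_eq_zero.1 hc0⟩

/-- No rule beats the optimum `max(y, c)` under complete information. -/
theorem payoff_le_max {δ c : ℝ} (hδ0 : 0 ≤ δ) (hδ1 : δ ≤ 1) (p : DecisionRule)
    (hI : Integrable (fun x : ℝ => x) (F : Measure ℝ))
    (hc : δ * ∫ x, max x c ∂(F : Measure ℝ) = c) {t : ℕ} (h : Fin (t + 1) → ℝ)
    (hh : 0 ≤ best h) : payoff δ p F h ≤ ENNReal.ofReal (max (best h) c) := by
  refine payoff_le_of_supersolution (g := fun y => ENNReal.ofReal (max y c)) (S := Set.Ici 0)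
    (fun y hy => Filter.Eventually.of_forall fun x => Set.mem_Ici.2 (le_max_of_le_left hy)) ?_ h hh
  intro t h (hh : 0 ≤ best h)
  set y := best h
  have hnn : ∀ x, 0 ≤ max (max y x) c := fun x => le_max_of_le_left (le_max_of_le_left hh)
  have hint : Integrable (fun x => max (max y x) c) (F : Measure ℝ) :=
    ((integrable_const y).sup hI).sup (integrable_const c)
  rw [← ofReal_integral_eq_lintegral_ofReal hint (Filter.Eventually.of_forall hnn),
    ofReal_recursion (p.prob_nonneg t h) (p.prob_le_one t h) hh hδ0 (integral_nonneg hnn)]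
  apply ENNReal.ofReal_le_ofReal
  -- Raising the best-so-far value from `c` to `max y c` raises the maximum by at most `max y c -
  -- c`, so the fixed-point equation for `c` applies.
  have hle : ∫ x, max (max y x) c ∂(F : Measure ℝ) ≤
      ∫ x, (max x c + (max y c - c)) ∂(F : Measure ℝ) := by
    refine integral_mono hint ((integrable_max hI c).add (integrable_const _)) fun x => ?_
    have h1 := le_max_left x c
    have h2 := le_max_right x c
    have h3 := le_max_left y c
    have h4 := le_max_right y c
    exact max_le (max_le (by linarith) (by linarith)) (by linarith)
  rw [integral_add (integrable_max hI c) (integrable_const _), integral_const, probReal_univ,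
    one_smul] at hle
  have h3 := le_max_left y c
  have h4 := le_max_right y c
  have h5 : δ * ∫ x, max (max y x) c ∂(F : Measure ℝ) ≤ max y c := by
    nlinarith [mul_le_mul_of_nonneg_left hle hδ0]
  nlinarith [p.prob_nonneg t h, p.prob_le_one t h]

/-- The rule `p^*` secures the fraction `ρ(y / B)` of the complete-information optimum. -/
theorem le_payoff_pStar {δ c B : ℝ} (hδ0 : 0 < δ) (hδ1 : δ < 1) (hB : 0 < B)
    (hI : Integrable (fun x : ℝ => x) (F : Measure ℝ))
    (hF : ∀ᵐ x ∂(F : Measure ℝ), x ∈ Set.Icc 0 B) (hcB : c ≤ B)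
    (hc : δ * ∫ x, max x c ∂(F : Measure ℝ) = c) {t : ℕ} (h : Fin (t + 1) → ℝ)
    (hh : 1 / 6 ≤ best h / B) (hhB : best h ≤ B) :
    ENNReal.ofReal (rho (best h / B) * max (best h) c) ≤ payoff δ (pStar δ B) F h := by
  have hrho : ∀ y, 0 ≤ y → y ≤ B → 0 ≤ rho (y / B) ∧ rho (y / B) ≤ 1 := fun y hy hyB => by
    refine ⟨?_, rho_le_one (by positivity) ((div_le_one hB).2 hyB)⟩
    unfold rho
    positivity
  refine le_payoff_of_subsolution (M := ENNReal.ofReal B) hδ1 ENNReal.ofReal_ne_top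
    (g := fun y => ENNReal.ofReal (rho (y / B) * max y c))
    (S := {y | 1 / 6 ≤ y / B ∧ y ≤ B}) ?_ ?_ ?_ h ⟨hh, hhB⟩
  · rintro y ⟨hy, hyB⟩
    have hy0 : 0 ≤ y := by
      rw [le_div_iff₀ hB] at hy
      linarith
    apply ENNReal.ofReal_le_ofReal
    have := hrho y hy0 hyB
    exact (mul_le_of_le_one_left (le_max_of_le_left hy0) this.2).trans (max_le hyB hcB)
  · rintro y ⟨hy, hyB⟩
    filter_upwards [hF] with x hx
    exact ⟨hy.trans (div_le_div_of_nonneg_right (le_max_left _ _) hB.le), max_le hyB hx.2⟩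
  · rintro t h ⟨hy, hyB⟩
    have hy0 : 0 ≤ best h := by
      rw [le_div_iff₀ hB] at hy
      linarith
    have hq := pStar_prob hδ1 hB h hy0 hyB
    have hq0 := (pStar δ B).prob_nonneg t h
    have hq1 := (pStar δ B).prob_le_one t h
    have hqr := qStar_mul (δ := δ) (y := best h / B) hδ1 (by linarith) ((div_le_one hB).2 hyB)
    rw [← hq] at hqr
    generalize (pStar δ B).prob t h = q at hq0 hq1 hqr ⊢
    clear hq
    generalize best h = y at hy hyB hy0 hqr ⊢
    obtain ⟨hr0, hr1⟩ := hrho y hy0 hyB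
    have hmono : ∀ x, rho (y / B) ≤ rho (max y x / B) := fun x =>
      rho_mono (by linarith) (div_le_div_of_nonneg_right (le_max_left _ _) hB.le)
    have hden : 0 < 1 - δ * rho (y / B) := by nlinarith
    -- It suffices to find an integrable minorant of the continuation value.
    suffices H : ∃ f : ℝ → ℝ, Integrable f (F : Measure ℝ) ∧ (∀ x, 0 ≤ f x) ∧
        (∀ x ∈ Set.Icc 0 B, f x ≤ rho (max y x / B) * max (max y x) c) ∧
        rho (y / B) * max y c ≤ q * y + (1 - q) * δ * ∫ x, f x ∂(F : Measure ℝ) by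
      obtain ⟨f, hf, hf0, hfle, hfin⟩ := H
      refine (ENNReal.ofReal_le_ofReal hfin).trans ?_
      rw [← ofReal_recursion hq0 hq1 hy0 hδ0.le (integral_nonneg hf0),
        ofReal_integral_eq_lintegral_ofReal hf (Filter.Eventually.of_forall hf0)]
      refine add_le_add le_rfl (mul_le_mul' le_rfl (lintegral_mono_ae ?_))
      filter_upwards [hF] with x hx using ENNReal.ofReal_le_ofReal (hfle x hx)
    rcases le_or_gt c y with hcy | hyc
    · refine ⟨fun _ => rho (y / B) * y, integrable_const _, fun _ => mul_nonneg hr0 hy0,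
        fun x hx => ?_, ?_⟩
      · exact mul_le_mul (hmono x) (le_max_of_le_left (le_max_left _ _)) hy0
          (hr0.trans (hmono x))
      · rw [max_eq_left hcy, integral_const, probReal_univ, one_smul]
        refine le_of_eq ?_
        linear_combination (-y) * hqr
    · have hr1' : rho (y / B) < 1 :=
        rho_lt_one (by linarith) ((div_lt_one hB).2 (hyc.trans_le hcB))
      set r := rho (y / B)
      have hc0 : 0 < c := hy0.trans_lt hyc
      -- The slope that turns the recursion into an equality, given that `max x c` has mean `c / δ`.
      set K := r * (c - y) / ((1 - r) * c) with hK
      have hK0 : 0 ≤ K :=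
        div_nonneg (mul_nonneg hr0 (by linarith)) (mul_nonneg (by linarith) hc0.le)
      have hKe : K * ((1 - r) * c) = r * (c - y) :=
        div_mul_cancel₀ _ (mul_pos (by linarith) hc0).ne'
      have hint := ((integrable_max hI c).const_mul K).add
        (integrable_const (μ := (F : Measure ℝ)) (r * c - K * c))
      refine ⟨fun x => K * max x c + (r * c - K * c), hint, fun x => ?_, fun x hx => ?_, ?_⟩
      · have := mul_le_mul_of_nonneg_left (le_max_right x c) hK0
        have := mul_nonneg hr0 hc0.le
        linarith
      · have hcd : y / B < c / B := div_lt_div_of_pos_right hyc hB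
        have key := rho_mul_max_ge hy hcd ((div_le_one hB).2 hx.2)
        have hKd : r * (c / B - y / B) / ((1 - r) * (c / B)) = K := by
          rw [hK, ← sub_div, mul_div_assoc', mul_div_assoc', div_div_div_cancel_right₀ hB.ne']
        rw [hKd, max_div_div_right hB.le, max_div_div_right hB.le,
          max_div_div_right hB.le, ← sub_div, mul_div_assoc', mul_div_assoc', mul_div_assoc',
          ← add_div, div_le_div_iff_of_pos_right hB] at key
        refine le_trans (le_of_eq ?_) key
        ring
      · rw [max_eq_right hyc.le, integral_add ((integrable_max hI c).const_mul K)
          (integrable_const _), integral_const_mul, integral_const, probReal_univ, one_smul]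
        refine le_of_eq (mul_left_cancel₀ hden.ne' ?_)
        linear_combination
          (-y + δ * (K * ∫ x, max x c ∂(F : Measure ℝ) + r * c - K * c)) * hqr
            - (1 - r) * K * hc - (1 - δ) * hKe

end Reservation

/-! ### From single environments to priors -/

theorem mem_of_likelihood_ne_zero {X : Set ℝ} {F : ProbabilityMeasure ℝ} (hF : F ∈ environments X)
    {t : ℕ} {h : Fin (t + 1) → ℝ} (hL : likelihood F h ≠ 0) (i : Fin t) : h i.succ ∈ X := by
  by_contra hi
  refine Finset.prod_ne_zero_iff.1 hL i (Finset.mem_univ i) (measure_mono_null ?_ hF.1)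
  simpa using hi

theorem ae_mem_Icc {X : Set ℝ} {B : ℝ} (hX0 : X ⊆ Set.Ici 0) (hB : B ∈ upperBounds X)
    {F : ProbabilityMeasure ℝ} (hF : F ∈ environments X) :
    ∀ᵐ x ∂(F : Measure ℝ), x ∈ Set.Icc 0 B := by
  have : ∀ᵐ x ∂(F : Measure ℝ), x ∈ X := hF.1
  filter_upwards [this] with x hx using ⟨hX0 hx, hB hx⟩

theorem rho_le_performanceRatio_pStar {δ : ℝ} (hδ0 : 0 < δ) (hδ1 : δ < 1) {X : Set ℝ}
    (hX0 : X ⊆ Set.Ici 0) {B : ℝ} (hB : B ∈ upperBounds X) {x₀ : ℝ} (hx0 : 0 < x₀)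
    (hx0B : x₀ ≤ B) (hx : 1 / 6 ≤ x₀ / B) :
    ENNReal.ofReal (rho (x₀ / B)) ≤ performanceRatio δ (pStar δ B) x₀ (environments X) := by
  have hB0 : 0 < B := hx0.trans_le hx0B
  refine le_iInf fun t => le_iInf fun h => le_iInf fun h0 => le_iInf₂ fun μ hμ => ?_
  obtain ⟨-, hμX, hμL⟩ := hμ
  have hxbest : x₀ ≤ best h := h0 ▸ le_best h 0
  have hbest : ∀ F, posterior μ h F ≠ 0 → F ∈ environments X ∧ best h ≤ B := fun F hF => by
    obtain ⟨h1, h2⟩ := posterior_ne_zero hF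
    refine ⟨hμX h1, best_le fun i => ?_⟩
    refine Fin.cases (h0 ▸ hx0B) (fun j => ?_) i
    exact hB (mem_of_likelihood_ne_zero (hμX h1) h2 j)
  have hopt0 : optimalPayoff δ μ h ≠ 0 := by
    have h1 : ENNReal.ofReal (best h) ≤ optimalPayoff δ μ h := by
      refine le_trans (le_of_eq ?_) (le_iSup (fun p => priorPayoff δ p μ h) (thresholdRule x₀))
      simp only [priorPayoff]
      rw [← one_mul (ENNReal.ofReal (best h)), ← tsum_posterior hμL, ← ENNReal.tsum_mul_right]
      simp_rw [payoff_thresholdRule_of_le δ _ hxbest]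
    exact ((ENNReal.ofReal_pos.2 (hx0.trans_le hxbest)).trans_le h1).ne'
  have hbound : ∀ F, posterior μ h F ≠ 0 → ∃ c ≤ B,
      (∀ p, payoff δ p F h ≤ ENNReal.ofReal (max (best h) c)) ∧
      ENNReal.ofReal (rho (best h / B) * max (best h) c) ≤ payoff δ (pStar δ B) F h :=
    fun F hF => by
    obtain ⟨hFX, hhB⟩ := hbest F hF
    have hae := ae_mem_Icc hX0 hB hFX
    obtain ⟨c, -, hcB, hc⟩ := exists_reservation hδ0.le hδ1.le hB0.le hFX.2 hae
    exact ⟨c, hcB, fun p => payoff_le_max hδ0.le hδ1.le p hFX.2 hc h (hx0.le.trans hxbest),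
      le_payoff_pStar hδ0 hδ1 hB0 hFX.2 hae hcB hc h
        (hx.trans (div_le_div_of_nonneg_right hxbest hB0.le)) hhB⟩
  have hopt1 : optimalPayoff δ μ h ≠ ∞ := by
    refine ne_top_of_le_ne_top (ENNReal.ofReal_ne_top (r := B)) (iSup_le fun p => ?_)
    rw [← one_mul (ENNReal.ofReal B), ← tsum_posterior hμL, ← ENNReal.tsum_mul_right]
    refine ENNReal.tsum_le_tsum fun F => ?_
    by_cases hF : posterior μ h F = 0
    · simp [hF]
    · obtain ⟨c, hcB, hc, -⟩ := hbound F hF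
      gcongr
      exact (hc p).trans (ENNReal.ofReal_le_ofReal (max_le (hbest F hF).2 hcB))
  rw [ENNReal.le_div_iff_mul_le (Or.inl hopt0) (Or.inl hopt1), optimalPayoff, ENNReal.mul_iSup]
  refine iSup_le fun p => ?_
  rw [priorPayoff, ← ENNReal.tsum_mul_left]
  refine ENNReal.tsum_le_tsum fun F => ?_
  by_cases hF : posterior μ h F = 0
  · simp [hF]
  · obtain ⟨c, -, hc, hc'⟩ := hbound F hF
    rw [mul_left_comm]
    gcongr
    refine le_trans ?_ hc'
    rw [ENNReal.ofReal_mul' (le_max_of_le_left (hx0.le.trans hxbest))]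
    gcongr
    · exact rho_mono (by linarith) (div_le_div_of_nonneg_right hxbest hB0.le)
    · exact hc p

/-! ### Two-point environments and zero histories -/

/-- The environment in which `z` has probability `σ` and `0` has probability `1 - σ`. -/
def twoPoint (σ z : ℝ) (h0 : 0 ≤ σ) (h1 : σ ≤ 1) : ProbabilityMeasure ℝ :=
  ⟨ENNReal.ofReal σ • Measure.dirac z + ENNReal.ofReal (1 - σ) • Measure.dirac 0, ⟨by
    simp only [Measure.coe_add, Measure.coe_smul, Pi.add_apply, Pi.smul_apply, measure_univ,
      smul_eq_mul, mul_one]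
    rw [← ENNReal.ofReal_add h0 (by linarith)]
    simp⟩⟩

section TwoPoint

variable {σ z : ℝ} (h0 : 0 ≤ σ) (h1 : σ ≤ 1)

theorem coe_twoPoint : (twoPoint σ z h0 h1 : Measure ℝ) =
    ENNReal.ofReal σ • Measure.dirac z + ENNReal.ofReal (1 - σ) • Measure.dirac 0 := rfl

theorem lintegral_twoPoint (f : ℝ → ℝ≥0∞) : ∫⁻ x, f x ∂(twoPoint σ z h0 h1 : Measure ℝ) =
    ENNReal.ofReal σ * f z + ENNReal.ofReal (1 - σ) * f 0 := by
  rw [coe_twoPoint, lintegral_add_measure, lintegral_smul_measure, lintegral_smul_measure,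
    lintegral_dirac, lintegral_dirac]
  rfl

theorem integrable_twoPoint (f : ℝ → ℝ) : Integrable f (twoPoint σ z h0 h1 : Measure ℝ) := by
  rw [coe_twoPoint]
  exact ((integrable_dirac (by simp)).smul_measure ENNReal.ofReal_ne_top).add_measure
    ((integrable_dirac (by simp)).smul_measure ENNReal.ofReal_ne_top)

theorem integral_twoPoint (f : ℝ → ℝ) : ∫ x, f x ∂(twoPoint σ z h0 h1 : Measure ℝ) =
    σ * f z + (1 - σ) * f 0 := by
  rw [coe_twoPoint, integral_add_measure
    ((integrable_dirac (by simp)).smul_measure ENNReal.ofReal_ne_top)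
    ((integrable_dirac (by simp)).smul_measure ENNReal.ofReal_ne_top), integral_smul_measure,
    integral_smul_measure, integral_dirac, integral_dirac, ENNReal.toReal_ofReal h0,
    ENNReal.toReal_ofReal (by linarith)]
  rfl

theorem twoPoint_mem_environments {X : Set ℝ} (hX : MeasurableSet X) (hz : z ∈ X)
    (h : (0 : ℝ) ∈ X) : twoPoint σ z h0 h1 ∈ environments X := by
  refine ⟨?_, integrable_twoPoint h0 h1 _⟩
  rw [coe_twoPoint]
  simp [hX.compl, hz, h]

theorem ae_twoPoint {P : ℝ → Prop} (hz : P z) (h : P 0) :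
    ∀ᵐ x ∂(twoPoint σ z h0 h1 : Measure ℝ), P x := by
  rw [coe_twoPoint, ae_add_measure_iff]
  refine ⟨Measure.ae_smul_measure ?_ _, Measure.ae_smul_measure ?_ _⟩
  · rw [ae_dirac_eq]
    exact hz
  · rw [ae_dirac_eq]
    exact h

/-- The history `(x₀, 0, …, 0)`. -/
def zeroHistory (x₀ : ℝ) (t : ℕ) : Fin (t + 1) → ℝ :=
  Fin.cons (α := fun _ => ℝ) x₀ fun _ => 0

theorem zeroHistory_zero (x₀ : ℝ) (t : ℕ) : zeroHistory x₀ t 0 = x₀ := rfl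

theorem best_zeroHistory {x₀ : ℝ} (hx₀ : 0 ≤ x₀) (t : ℕ) : best (zeroHistory x₀ t) = x₀ := by
  refine le_antisymm (best_le fun i => ?_) (le_best (zeroHistory x₀ t) 0)
  exact Fin.cases le_rfl (fun j => by simpa [zeroHistory] using hx₀) i

theorem extend_zeroHistory (x₀ : ℝ) (t : ℕ) :
    extend (zeroHistory x₀ t) 0 = zeroHistory x₀ (t + 1) := by
  funext i
  refine Fin.lastCases ?_ (fun j => ?_) i
  · rw [extend, Fin.snoc_last, ← Fin.succ_last]
    rfl
  · rw [extend, Fin.snoc_castSucc]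
    refine Fin.cases rfl (fun k => ?_) j
    rw [← Fin.succ_castSucc]
    rfl

theorem likelihood_zeroHistory_ne_zero (hσ : σ < 1) (x₀ : ℝ) (t : ℕ) :
    likelihood (twoPoint σ z h0 hσ.le) (zeroHistory x₀ t) ≠ 0 := by
  refine Finset.prod_ne_zero_iff.2 fun i _ => ?_
  have : 0 < ENNReal.ofReal (1 - σ) := ENNReal.ofReal_pos.2 (by linarith)
  rw [coe_twoPoint]
  simp [zeroHistory, hσ]

/-- The optimal payoff in a two-point environment after the history `(x₀, 0, …, 0)`. -/
theorem le_payoff_thresholdRule {δ γ x₀ c : ℝ} (hδ0 : 0 ≤ δ) (hδ1 : δ < 1)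
    (hγ : γ = δ * (1 - σ)) (hc : (1 - γ) * c = (δ - γ) * z) (hc0 : 0 ≤ c) (hx₀ : 0 ≤ x₀)
    (hx₀z : x₀ < z) (t : ℕ) : ENNReal.ofReal c ≤
      payoff δ (thresholdRule z) (twoPoint σ z h0 h1) (zeroHistory x₀ t) := by
  have hz0 : 0 ≤ z := hx₀.trans hx₀z.le
  have := le_payoff_of_subsolution (δ := δ) (p := thresholdRule z) (F := twoPoint σ z h0 h1)
    (g := fun y => if z ≤ y then ENNReal.ofReal y else ENNReal.ofReal c) (S := {x₀, z})
    (M := ENNReal.ofReal z + ENNReal.ofReal c) hδ1 (by simp) ?_ ?_ ?_ (zeroHistory x₀ t)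
    (by rw [best_zeroHistory hx₀]; exact Or.inl rfl)
  · rwa [best_zeroHistory hx₀, if_neg hx₀z.not_ge] at this
  · rintro y (rfl | rfl)
    · simp [hx₀z.not_ge]
    · simp
  · rintro y (rfl | rfl) <;> refine ae_twoPoint h0 h1 ?_ ?_
    · exact Or.inr (max_eq_right hx₀z.le)
    · exact Or.inl (max_eq_left hx₀)
    · exact Or.inr (max_self _)
    · exact Or.inr (max_eq_left hz0)
  · rintro t h (hy | hy)
    · rw [lintegral_twoPoint, hy, max_eq_right hx₀z.le, max_eq_left hx₀, if_neg hx₀z.not_ge,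
        if_pos le_rfl]
      have hp : (thresholdRule z).prob t h = 0 := if_neg (by rw [hy]; exact hx₀z.not_ge)
      have h2 : 0 ≤ 1 - σ := by linarith
      rw [hp, ← ENNReal.ofReal_mul h0, ← ENNReal.ofReal_mul h2,
        ← ENNReal.ofReal_add (by positivity) (by positivity),
        ofReal_recursion le_rfl zero_le_one hx₀ hδ0 (by positivity)]
      apply ENNReal.ofReal_le_ofReal
      refine le_of_eq ?_
      subst hγ
      linear_combination hc
    · have hp : (thresholdRule z).prob t h = 1 := if_pos (le_of_eq hy.symm)
      rw [hp, hy]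
      simp

end TwoPoint

/-! ### Upper bounds on the performance ratio -/

/-- In the environment that only yields 0, stationarity gives `p^*` exactly `ρ x₀`, while stopping
at once gives `x₀`. -/
theorem performanceRatio_pStar_le_rho {δ : ℝ} (hδ0 : 0 < δ) (hδ1 : δ < 1) {X : Set ℝ}
    (hX : MeasurableSet X) (h0X : (0 : ℝ) ∈ X) {B : ℝ} {x₀ : ℝ} (hx0 : 0 < x₀)
    (hx0B : x₀ ≤ B) :
    performanceRatio δ (pStar δ B) x₀ (environments X) ≤ ENNReal.ofReal (rho (x₀ / B)) := by
  have hB0 : 0 < B := hx0.trans_le hx0B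
  have hx1 : x₀ / B ≤ 1 := (div_le_one hB0).2 hx0B
  have hr0 : 0 < rho (x₀ / B) := one_half_pos.trans (half_lt_rho (by positivity))
  have hr1 : rho (x₀ / B) ≤ 1 := rho_le_one (by positivity) hx1
  have hbest := best_zeroHistory hx0.le 0
  have h1 := performanceRatio_le_div (δ := δ) (p := pStar δ B) (p' := thresholdRule x₀)
    (twoPoint_mem_environments le_rfl zero_le_one hX h0X h0X)
    (likelihood_zeroHistory_ne_zero (z := 0) le_rfl one_pos x₀ 0)
  rw [zeroHistory_zero, payoff_thresholdRule_of_le _ _ hbest.ge, hbest] at h1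
  refine h1.trans (ENNReal.div_le_of_le_mul ?_)
  rw [← ENNReal.ofReal_mul hr0.le]
  have h2 := payoff_le_of_supersolution (δ := δ) (p := pStar δ B)
    (F := twoPoint 0 0 le_rfl zero_le_one)
    (g := fun _ => ENNReal.ofReal (rho (x₀ / B) * x₀)) (S := {x₀}) ?_ ?_ (zeroHistory x₀ 0) hbest
  · exact h2
  · rintro y rfl
    exact ae_twoPoint _ _ (max_eq_left hx0.le) (max_eq_left hx0.le)
  · rintro t h (hh : best h = x₀)
    rw [lintegral_const, measure_univ, mul_one,
      ofReal_recursion ((pStar δ B).prob_nonneg t h) ((pStar δ B).prob_le_one t h)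
        (hh ▸ hx0.le) hδ0.le (by positivity),
      pStar_prob hδ1 hB0 h (hh ▸ hx0.le) (hh ▸ hx0B), hh]
    apply ENNReal.ofReal_le_ofReal
    have := qStar_mul hδ1 (y := x₀ / B) (by positivity) hx1
    refine le_of_eq ?_
    linear_combination x₀ * this

/-- Parameters of an environment that is unfavourable for the ratio `R > ρ(y)`: `γ` is `δ` times the
probability of `0`, and the other alternative `z` may be anything close to `1`. -/
theorem exists_adverse_parameters {δ y R : ℝ} (hδ0 : 0 < δ) (hδ1 : δ < 1) (hy0 : 0 < y)
    (hy : y ≤ δ ^ 2 / (2 - δ)) (hyR : rho y < R) (hR : R < 1) :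
    ∃ γ, 0 < γ ∧ γ < δ ∧ ∃ ε, 0 < ε ∧ ∀ z c : ℝ, 1 - ε < z → z ≤ 1 →
      (1 - γ) * c = (δ - γ) * z → y < R * c ∧
      (1 - R) * ((1 - γ) * (c - y) + γ * (R * c - y)) < (R * c - y) * (1 - δ * R) := by
  have hr := half_lt_rho hy0
  have hry := rho_mul_self hy0.le
  set r := rho y
  have hr1 : r < 1 := hyR.trans hR
  -- The only use of the upper bound on `y`; it makes `γ₀` nonnegative.
  have hk : r * (2 - δ) ≤ 1 := by
    rw [le_div_iff₀ (by linarith)] at hy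
    have h1 : (4 * r - (2 - δ)) * ((2 - δ) * r - 1) ≤ 0 := by
      have := mul_le_mul_of_nonneg_left hy (by linarith : 0 ≤ r)
      linear_combination this + (-(2 - δ)) * hry
    nlinarith [nonpos_of_mul_nonpos_right h1 (by linarith)]
  have hr1' : 1 - r ≠ 0 := by linarith
  have hr0' : r ≠ 0 := by linarith
  -- Chosen so that for `z = 1` the reservation value is the double root `(2 * r - 1) / r`.
  set γ₀ := (δ * r - 2 * r + 1) / (1 - r) with hγ₀
  have hγe : γ₀ * (1 - r) = δ * r - 2 * r + 1 := div_mul_cancel₀ _ hr1'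
  have hγ0 : 0 ≤ γ₀ := div_nonneg (by linarith) (by linarith)
  have hγδ : γ₀ < δ := by
    rw [hγ₀, div_lt_iff₀ (by linarith)]
    nlinarith
  let c : ℝ × ℝ → ℝ := fun p => p.2 * (δ - p.1) / (1 - p.1)
  let A : ℝ × ℝ → ℝ := fun p => R * c p - y
  let D : ℝ × ℝ → ℝ := fun p => (R * c p - y) * (1 - δ * R)
    - (1 - R) * ((1 - p.1) * (c p - y) + p.1 * (R * c p - y))
  have hcc : ContinuousAt c (γ₀, 1) := by
    refine ContinuousAt.div (by fun_prop) (by fun_prop) ?_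
    change 1 - γ₀ ≠ 0
    linarith
  have hAc : ContinuousAt A (γ₀, 1) := (continuousAt_const.mul hcc).sub continuousAt_const
  have hDc : ContinuousAt D (γ₀, 1) :=
    (hAc.mul continuousAt_const).sub (continuousAt_const.mul
      (((continuousAt_const.sub continuousAt_fst).mul (hcc.sub continuousAt_const)).add
        (continuousAt_fst.mul hAc)))
  have hc0 : r * c (γ₀, 1) = 2 * r - 1 := by
    change r * (1 * (δ - γ₀) / (1 - γ₀)) = 2 * r - 1
    have h1 : 1 - γ₀ ≠ 0 := by linarith
    field_simp
    refine mul_left_cancel₀ hr1' ?_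
    linear_combination (r - 1) * hγe
  have hrA : 0 < r * (r * c (γ₀, 1) - y) := by
    have : r * (r * c (γ₀, 1) - y) = (2 * r - 1) * (1 - r) := by
      linear_combination r * hc0 - hry
    rw [this]
    exact mul_pos (by linarith) (by linarith)
  have hcpos : 0 < c (γ₀, 1) := by nlinarith
  have hA1 : 0 < r * c (γ₀, 1) - y :=
    (mul_pos_iff_of_pos_left (by linarith)).1 hrA
  have hA0 : 0 < A (γ₀, 1) := by
    change 0 < R * c (γ₀, 1) - y
    nlinarith
  have hD0 : 0 < D (γ₀, 1) := by
    have hcy : 0 < c (γ₀, 1) - y := by nlinarith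
    have h1 : (1 - r) * D (γ₀, 1) = (R - r) * ((c (γ₀, 1) - y) * (1 - δ)
        + c (γ₀, 1) * (δ - γ₀) * (1 - R) * (1 - r)) := by
      -- At `R = r` the target inequality is an equality; the surplus for `R > r` is the factor `R -
      -- r` in `h1`.
      have hDr : (r * c (γ₀, 1) - y) * (1 - δ * r - γ₀ * (1 - r))
          - (1 - r) * (1 - γ₀) * (c (γ₀, 1) - y) = 0 := by
        refine (mul_eq_zero_iff_left hr0').1 ?_
        linear_combination
          (r * (1 - δ * r - γ₀ * (1 - r)) - (1 - r) * (1 - γ₀)) * hc0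
            - ((1 - δ * r - γ₀ * (1 - r)) - (1 - r) * (1 - γ₀)) * hry
            + (2 * r - 1) * (1 - r) * hγe
      simp only [D]
      linear_combination (1 - R) * hDr
    have h2 : 0 < (R - r) * ((c (γ₀, 1) - y) * (1 - δ)
        + c (γ₀, 1) * (δ - γ₀) * (1 - R) * (1 - r)) := by
      refine mul_pos (by linarith) (add_pos (mul_pos hcy (by linarith)) ?_)
      exact mul_pos (mul_pos (mul_pos hcpos (by linarith)) (by linarith)) (by linarith)
    rw [← h1] at h2
    exact (mul_pos_iff_of_pos_left (by linarith)).1 h2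
  obtain ⟨ε, hε, H⟩ := Metric.eventually_nhds_iff.1
    ((hAc.eventually_const_lt hA0).and (hDc.eventually_const_lt hD0))
  have hm : 0 < min ε (δ - γ₀) := lt_min hε (by linarith)
  have hm1 := min_le_left ε (δ - γ₀)
  have hm2 := min_le_right ε (δ - γ₀)
  -- Since `γ₀` may be 0, it is moved up slightly: 0 must have positive probability for the zero
  -- histories to occur.
  refine ⟨γ₀ + min ε (δ - γ₀) / 2, by linarith, by linarith, ε, hε, fun z d hz hz1 hd => ?_⟩
  set γ := γ₀ + min ε (δ - γ₀) / 2 with hγ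
  have hdist : dist (γ, z) (γ₀, (1 : ℝ)) < ε := by
    rw [Prod.dist_eq, max_lt_iff, Real.dist_eq, Real.dist_eq, abs_lt, abs_lt]
    refine ⟨⟨?_, ?_⟩, ?_, ?_⟩ <;> simp only [hγ] <;> linarith
  have hdc : c (γ, z) = d := by
    change z * (δ - γ) / (1 - γ) = d
    rw [div_eq_iff (by linarith)]
    linarith
  obtain ⟨h1, h2⟩ := H hdist
  simp only [A, D, hdc] at h1 h2
  exact ⟨by linarith, by linarith⟩

theorem payoff_zeroHistory_eq (δ : ℝ) (p : DecisionRule) {σ z : ℝ} (h0 : 0 ≤ σ) (h1 : σ ≤ 1)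
    {x₀ : ℝ} (hx₀ : 0 ≤ x₀) (t : ℕ) :
    payoff δ p (twoPoint σ z h0 h1) (zeroHistory x₀ t) =
      ENNReal.ofReal (p.prob t (zeroHistory x₀ t)) * ENNReal.ofReal x₀ +
        ENNReal.ofReal (1 - p.prob t (zeroHistory x₀ t)) * ENNReal.ofReal δ *
          (ENNReal.ofReal σ * payoff δ p (twoPoint σ z h0 h1) (extend (zeroHistory x₀ t) z) +
            ENNReal.ofReal (1 - σ) *
              payoff δ p (twoPoint σ z h0 h1) (zeroHistory x₀ (t + 1))) := by
  rw [payoff_eq, lintegral_twoPoint, best_zeroHistory hx₀, extend_zeroHistory]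

/-- No rule guarantees more than the fraction `ρ(x₀ / B)`. -/
theorem performanceRatio_le_rho {δ : ℝ} (hδ0 : 0 < δ) (hδ1 : δ < 1) {X : Set ℝ}
    (hX : MeasurableSet X) (h0X : (0 : ℝ) ∈ X) {B : ℝ} (hB : IsLUB X B) {x₀ : ℝ}
    (hx0 : 0 < x₀) (hx0B : x₀ ≤ B) (hx : x₀ / B ≤ δ ^ 2 / (2 - δ)) (p : DecisionRule) :
    performanceRatio δ p x₀ (environments X) ≤ ENNReal.ofReal (rho (x₀ / B)) := by
  have hB0 : 0 < B := hx0.trans_le hx0B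
  have hy0 : 0 < x₀ / B := by positivity
  have hr0 : 1 / 2 < rho (x₀ / B) := half_lt_rho hy0
  have hr1 : rho (x₀ / B) < 1 := by
    refine rho_lt_one hy0.le (hx.trans_lt ?_)
    rw [div_lt_one (by linarith)]
    nlinarith
  by_contra! hlt
  obtain ⟨R', hR', hR'lt⟩ := exists_between (lt_min hlt
    ((ENNReal.ofReal_lt_one).2 hr1))
  rw [lt_min_iff] at hR'lt
  obtain ⟨R, rfl⟩ : ∃ R, ENNReal.ofReal R = R' :=
    ⟨R'.toReal, ENNReal.ofReal_toReal (ne_top_of_lt hR'lt.2)⟩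
  have hrR : rho (x₀ / B) < R := (ENNReal.ofReal_lt_ofReal_iff_of_nonneg (by linarith)).1 hR'
  have hR1 : R < 1 := ENNReal.ofReal_lt_one.1 hR'lt.2
  have hR0 : 0 < R := by linarith
  obtain ⟨γ, hγ0, hγδ, ε, hε, hadv⟩ := exists_adverse_parameters hδ0 hδ1 hy0 hx hrR hR1
  -- The supremum need not belong to `X`, so an alternative close to it is used.
  obtain ⟨z, hzX, hzε, hzB⟩ := hB.exists_between (show B * (1 - ε) < B by nlinarith)
  have hγ1 : γ < 1 := hγδ.trans hδ1
  obtain ⟨c, hc⟩ : ∃ c, (1 - γ) * c = (δ - γ) * z :=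
    ⟨(δ - γ) * z / (1 - γ), mul_div_cancel₀ _ (by linarith)⟩
  obtain ⟨hyc, hineq⟩ := hadv (z / B) (c / B) ((lt_div_iff₀' hB0).2 hzε) ((div_le_one hB0).2 hzB)
    (by rw [mul_div_assoc', mul_div_assoc', hc])
  rw [mul_div_assoc', div_lt_div_iff_of_pos_right hB0] at hyc
  have hineq : (1 - R) * ((1 - γ) * (c - x₀) + γ * (R * c - x₀)) <
      (R * c - x₀) * (1 - δ * R) := by
    rw [← mul_lt_mul_iff_of_pos_right hB0] at hineq
    field_simp at hineq
    linarith
  have hc0 : 0 < c := (mul_pos_iff_of_pos_left hR0).1 (hx0.trans hyc)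
  have hxc : x₀ < c := by nlinarith
  have hcz : c < z := by nlinarith
  have hxz : x₀ < z := hxc.trans hcz
  set σ := (δ - γ) / δ with hσdef
  have hσδ : δ * σ = δ - γ := mul_div_cancel₀ _ hδ0.ne'
  have hσ0 : 0 ≤ σ := div_nonneg (by linarith) hδ0.le
  have hσ1 : σ < 1 := (div_lt_one hδ0).2 (by linarith)
  have hγσ : γ = δ * (1 - σ) := by linarith
  -- the environment without valuable alternatives
  set F₀ := twoPoint 0 0 le_rfl zero_le_one with hF₀
  set F₁ := twoPoint σ z hσ0 hσ1.le with hF₁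
  set H := zeroHistory x₀ with hH
  have hbest : ∀ t, best (H t) = x₀ := best_zeroHistory hx0.le
  have hA : ∀ t, payoff δ p F₀ (H t) ≤ ENNReal.ofReal x₀ := fun t => by
    have := payoff_le_max (F := F₀) (c := 0) hδ0.le hδ1.le p (integrable_twoPoint _ _ _)
      (by rw [integral_twoPoint]; simp) (H t) ((hbest t).symm ▸ hx0.le)
    rwa [hbest, max_eq_left hx0.le] at this
  have hres : δ * ∫ x, max x c ∂(F₁ : Measure ℝ) = c := by
    rw [integral_twoPoint, max_eq_left hcz.le, max_eq_right hc0.le]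
    linear_combination (z - c) * hσδ - hc
  have hE : ∀ t, payoff δ p F₁ (H t) ≤ ENNReal.ofReal c := fun t => by
    have := payoff_le_max hδ0.le hδ1.le p (integrable_twoPoint _ _ _) hres (H t)
      ((hbest t).symm ▸ hx0.le)
    rwa [hbest, max_eq_right hxc.le] at this
  have hZ : ∀ t, payoff δ p F₁ (extend (H t) z) ≤ ENNReal.ofReal z := fun t => by
    have hb : best (extend (H t) z) = z := by rw [best_extend, hbest, max_eq_right hxz.le]
    have := payoff_le_max hδ0.le hδ1.le p (integrable_twoPoint _ _ _) hres (extend (H t) z)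
      (hb.symm ▸ (hx0.trans hxz).le)
    rwa [hb, max_eq_left hcz.le] at this
  have hRA : ∀ t, ENNReal.ofReal (R * x₀) ≤ payoff δ p F₀ (H t) := fun t => by
    have h1 := performanceRatio_le_div (δ := δ) (p := p) (p' := thresholdRule x₀)
      (twoPoint_mem_environments le_rfl zero_le_one hX h0X h0X)
      (likelihood_zeroHistory_ne_zero (z := 0) le_rfl one_pos x₀ t)
    rw [zeroHistory_zero, payoff_thresholdRule_of_le _ _ (hbest t).ge] at h1
    rw [ENNReal.ofReal_mul hR0.le]
    have := ENNReal.mul_le_of_le_div (hR'lt.1.le.trans h1)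
    rwa [hbest] at this
  have hRE : ∀ t, ENNReal.ofReal (R * c) ≤ payoff δ p F₁ (H t) := fun t => by
    have h1 := performanceRatio_le_div (δ := δ) (p := p) (p' := thresholdRule z)
      (twoPoint_mem_environments hσ0 hσ1.le hX hzX h0X)
      (likelihood_zeroHistory_ne_zero (z := z) hσ0 hσ1 x₀ t)
    rw [zeroHistory_zero] at h1
    rw [ENNReal.ofReal_mul hR0.le]
    refine le_trans ?_ (ENNReal.mul_le_of_le_div (hR'lt.1.le.trans h1))
    gcongr
    exact le_payoff_thresholdRule hσ0 hσ1.le hδ0.le hδ1 hγσ hc hc0.le hx0.le hxz t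
  have hcx : 0 < c - x₀ := by linarith
  set q : ℕ → ℝ := fun t => p.prob t (H t)
  set α : ℕ → ℝ := fun t => (payoff δ p F₀ (H t)).toReal
  set β : ℕ → ℝ := fun t => (payoff δ p F₁ (H t)).toReal
  have hα : ∀ t, payoff δ p F₀ (H t) = ENNReal.ofReal (α t) := fun t =>
    (ENNReal.ofReal_toReal (ne_top_of_le_ne_top ENNReal.ofReal_ne_top (hA t))).symm
  have hβ : ∀ t, payoff δ p F₁ (H t) = ENNReal.ofReal (β t) := fun t =>
    (ENNReal.ofReal_toReal (ne_top_of_le_ne_top ENNReal.ofReal_ne_top (hE t))).symm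
  have hα0 : ∀ t, 0 ≤ α t := fun t => ENNReal.toReal_nonneg
  have hβ0 : ∀ t, 0 ≤ β t := fun t => ENNReal.toReal_nonneg
  have hq0 : ∀ t, 0 ≤ q t := fun t => p.prob_nonneg t _
  have hq1 : ∀ t, q t ≤ 1 := fun t => p.prob_le_one t _
  have hαx : ∀ t, α t ≤ x₀ := fun t => by
    have := hA t
    rwa [hα, ENNReal.ofReal_le_ofReal_iff hx0.le] at this
  have hβc : ∀ t, β t ≤ c := fun t => by
    have := hE t
    rwa [hβ, ENNReal.ofReal_le_ofReal_iff hc0.le] at this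
  have hαR : ∀ t, R * x₀ ≤ α t := fun t => by
    have := hRA t
    rwa [hα, ENNReal.ofReal_le_ofReal_iff (hα0 t)] at this
  have hβR : ∀ t, R * c ≤ β t := fun t => by
    have := hRE t
    rwa [hβ, ENNReal.ofReal_le_ofReal_iff (hβ0 t)] at this
  have hrecα : ∀ t, α t = q t * x₀ + (1 - q t) * δ * α (t + 1) := fun t => by
    have := payoff_zeroHistory_eq δ p (z := 0) le_rfl zero_le_one hx0.le t
    rw [← hF₀, ← hH, hα, hα, ENNReal.ofReal_zero, zero_mul, zero_add, sub_zero,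
      ENNReal.ofReal_one, one_mul,
      ofReal_recursion (hq0 t) (hq1 t) hx0.le hδ0.le (hα0 (t + 1))] at this
    have h1 : 0 ≤ 1 - q t := by linarith [hq1 t]
    exact (ENNReal.ofReal_eq_ofReal_iff (hα0 t) (add_nonneg (mul_nonneg (hq0 t) hx0.le)
      (mul_nonneg (mul_nonneg h1 hδ0.le) (hα0 _)))).1 this
  have hrecβ : ∀ t, β t ≤ q t * x₀ + (1 - q t) * δ * (σ * z + (1 - σ) * β (t + 1)) := fun t => by
    have := payoff_zeroHistory_eq δ p (z := z) hσ0 hσ1.le hx0.le t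
    rw [← hF₁, ← hH, hβ, hβ] at this
    have h1 : 0 ≤ 1 - q t := by linarith [hq1 t]
    have h2 : 0 ≤ 1 - σ := by linarith
    have h3 := hβ0 (t + 1)
    have hz0 : 0 ≤ z := (hx0.trans hxz).le
    have h4 : ENNReal.ofReal (β t) ≤ ENNReal.ofReal (q t) * ENNReal.ofReal x₀ +
        ENNReal.ofReal (1 - q t) * ENNReal.ofReal δ *
          ENNReal.ofReal (σ * z + (1 - σ) * β (t + 1)) := by
      rw [this, ENNReal.ofReal_add (by positivity) (by positivity), ENNReal.ofReal_mul hσ0,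
        ENNReal.ofReal_mul h2]
      exact add_le_add le_rfl (mul_le_mul' le_rfl
        (add_le_add (mul_le_mul' le_rfl (hZ t)) le_rfl))
    rw [ofReal_recursion (hq0 t) (hq1 t) hx0.le hδ0.le (by positivity)] at h4
    refine (ENNReal.ofReal_le_ofReal_iff ?_).1 h4
    have := hq0 t
    positivity
  -- Here `a` is the relative loss in the worthless environment and `e` is the gain over `x₀` as a
  -- share of the largest possible gain. Both normalisations leave `1 - q t` as a common factor.
  refine false_of_recursions (δ := δ) (γ := γ) (ε := 1 - R) (η := (R * c - x₀) / (c - x₀))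
    (q := q) (a := fun t => 1 - α t / x₀) (e := fun t => (β t - x₀) / (c - x₀)) hδ0.le hδ1
    hγ0.le hγ1 (div_pos (by linarith) hcx) ?_ ?_ ?_ ?_ ?_ ?_ ?_
  · intro t
    exact sub_nonneg.2 ((div_le_one hx0).2 (hαx t))
  · intro t
    exact sub_le_sub_left ((le_div_iff₀ hx0).2 (hαR t)) 1
  · intro t
    exact div_le_div_of_nonneg_right (by linarith [hβR t]) hcx.le
  · intro t
    exact (div_le_one hcx).2 (by linarith [hβc t])
  · intro t
    refine le_of_eq ?_
    simp only [hrecα t]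
    field_simp
    ring
  · intro t
    rw [div_le_iff₀ hcx]
    have h1 : (1 - q t) * (1 - γ + γ * ((β (t + 1) - x₀) / (c - x₀))) * (c - x₀) =
        (1 - q t) * ((1 - γ) * (c - x₀) + γ * (β (t + 1) - x₀)) := by
      field_simp
    rw [h1]
    refine (sub_le_sub_right (hrecβ t) x₀).trans (le_of_eq ?_)
    rw [hγσ] at hc ⊢
    linear_combination (-(1 - q t)) * hc
  · have h1 : (1 - R) * (1 - γ + γ * ((R * c - x₀) / (c - x₀))) =
        (1 - R) * ((1 - γ) * (c - x₀) + γ * (R * c - x₀)) / (c - x₀) := by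
      field_simp
    have h2 : (R * c - x₀) / (c - x₀) * (1 - δ + δ * (1 - R)) =
        (R * c - x₀) * (1 - δ * R) / (c - x₀) := by
      ring
    rw [h1, h2]
    exact div_lt_div_of_pos_right hineq hcx

end RobustSearch

end

theorem mainTheorem4 :
    ∃ L : ℝ, 0 < L ∧ L < 1 ∧
      ∀ (δ : ℝ) (_ : 0 < δ) (_ : δ < 1)
        (X : Set ℝ) (_ : MeasurableSet X) (_ : X ⊆ Set.Ici 0) (_ : (0 : ℝ) ∈ X)
        (xbar : ℝ) (_ : IsLUB X xbar)
        (x₀ : ℝ) (_ : 0 < x₀) (_ : x₀ ≤ xbar),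
        (L ≤ x₀ / xbar →
          ENNReal.ofReal (RobustSearch.rho (x₀ / xbar)) ≤
              RobustSearch.robustRatio δ x₀ (RobustSearch.environments X) ∧
            1 / 2 < RobustSearch.rho (x₀ / xbar)) ∧
        (1 / 6 ≤ x₀ / xbar →
          RobustSearch.performanceRatio δ (RobustSearch.pStar δ xbar) x₀
                (RobustSearch.environments X) =
              ENNReal.ofReal (RobustSearch.rho (x₀ / xbar)) ∧
            1 / 2 < RobustSearch.rho (x₀ / xbar) ∧
            (x₀ / xbar ≤ δ ^ 2 / (2 - δ) →
              RobustSearch.IsDynamicallyRobust δ (RobustSearch.pStar δ xbar) x₀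
                (RobustSearch.environments X))) := by
  refine ⟨1 / 6, by norm_num, by norm_num, ?_⟩
  intro δ hδ0 hδ1 X hX hX0 h0X xbar hxbar x₀ hx0 hx0B
  have hlow := RobustSearch.rho_le_performanceRatio_pStar hδ0 hδ1 hX0 hxbar.1 hx0 hx0B
  have hhalf : 1 / 2 < RobustSearch.rho (x₀ / xbar) :=
    RobustSearch.half_lt_rho (div_pos hx0 (hx0.trans_le hx0B))
  refine ⟨fun hL => ⟨(hlow hL).trans (le_iSup (fun p => RobustSearch.performanceRatio δ p x₀
    (RobustSearch.environments X)) _), hhalf⟩, fun h6 => ?_⟩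
  have heq := le_antisymm
    (RobustSearch.performanceRatio_pStar_le_rho hδ0 hδ1 hX h0X hx0 hx0B) (hlow h6)
  refine ⟨heq, hhalf, fun hub => le_antisymm (le_iSup (fun p => RobustSearch.performanceRatio δ p
    x₀ (RobustSearch.environments X)) _) (iSup_le fun p => ?_)⟩
  rw [heq]
  exact RobustSearch.performanceRatio_le_rho hδ0 hδ1 hX h0X hxbar hx0 hx0B hub p
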